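/- \textbf{Corollary.} Let $\mathbb{F}$ be the category with objects the natural numbers and morphisms $m\to n$ the functions $\{0,\dots,m-1\}\to\{0,\dots,n-1\}$. A Lawvere theory is an identity-on-objects finite-product-preserving functor $L:\mathbb{F}^{\mathrm{op}}\to\mathcal{L}$; a morphism $(\mathcal{L},L)\to(\mathcal{L}',L')$ is a functor $G:\mathcal L\to\mathcal L'$ with $GL=L'$. Let $V=\mathbb{F}(1,-)$ in the topos $\mathcal{F}=\mathbf{Set}^{\mathbb{F}}$. The functor $T=(-)^V$ is a symmetric monad on $\mathcal{F}$, with multiplication $\mu(\varphi)(a)=\varphi(a)(a)$, unit $\eta(x)(a)=x$ and symmetry $\varsigma(\varphi)(a)(b)=\varphi(b)(a)$ (in the internal language), and it preserves finite products. A substitution algebra is an object $A$ of $\mathcal{F}$ with morphisms $s:A^V\times A\to A$ and $v:1\to A^V$ that satisfy, in the internal language, with $x[y]$ for $s(x,y)$: \begin{enumerate} \item $v[x]=x$ for $x:A$; \item $\big(a\mapsto x(a)[v(a)]\big)=\mu(x)$ for $x:(A^V)^V$, where $a:V$ and $v$ is regarded as a map $V\to A$; \item $\eta(x)[y]=x$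 for $x,y:A$; \item $\big(a\mapsto x(a)[y(a)]\big)[z]=\big(b\mapsto (a\mapsto x(a)(b))[z]\big)\big[y[z]\big]$ for $x:(A^V)^V$, $y:A^V$, $z:A$. \end{enumerate} A homomorphism of substitution algebras is a morphism of underlying objects that commutes with $s$ and $v$. An algebraic presentation in $\mathcal F$ consists of operators, each with an arity $P$ and a coarity $Q$ in $\mathcal{F}$ (interpreted on $A$ as morphisms $A^P\to A^Q$), and of equations between terms of equal arity and coarity; terms are generated from the operators by change of variables $A^f:A^P\to A^Q$ (for $f:Q\to P$), composition, pairing $A^P\to A^Q\times A^R\cong A^{Q+R}$, and parameterization, which takes a term of arity $P$ and coarity $Q$ to the term $A^{R\times P}\cong(A^P)^R\to(A^Q)^R\cong A^{R\times Q}$. Then: \begin{enumerate} \item[(a)] The category of Lawvere theories is equivalent to the category of substitution algebras in $\mathbf{Set}^{\mathbb{F}}$, by an equivalence under which the underlying object of the substitution algebra of $(\mathcal{L},L)$ is naturally isomorphic to the presheaf $n\mapsto\mathcal{L}(n,1)$ (with $\mathbb{F}$ acting by precomposition with $L$). \item[(b)] Substitution algebras are, up to an equivalence compatible with the underlying objects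 in $\mathcal{F}$, the algebras of the algebraic presentation in $\mathcal{F}$ that has exactly two operators, of arity--coarity $(V+1,1)$ and $(0,V)$, and the four equations (1)--(4) above. \end{enumerate} -/

import Mathlib

open CategoryTheory Limits MonoidalCategory CartesianMonoidalCategory MonoidalClosed
open scoped CategoryTheory.CartesianClosed

universe u v

noncomputable section

/-! ## The category of finite cardinals and Lawvere theories -/

/-- The category `F`: its objects are the natural numbers and its morphisms `m ⟶ n` are the
functions `{0, …, m-1} → {0, …, n-1}`. -/
structure FinCard where
  len : ℕ

instance FinCard.category : Category.{0} FinCard where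
  Hom m n := Fin m.len → Fin n.len
  id _ := fun i => i
  comp f g := fun i => g (f i)

/-- A category whose set of objects is `ℕ`, together with an identity-on-objects functor into it
from `Fᵒᵖ`: a morphism `m ⟶ n` of `Fᵒᵖ`, that is a function `Fin n → Fin m`, is sent to an
element of `Hom m n`. Composition is written in diagrammatic order. -/
structure PreLawvereTheory where
  Hom : ℕ → ℕ → Type u
  id : ∀ n, Hom n n
  comp : ∀ {l m n}, Hom l m → Hom m n → Hom l n
  id_comp : ∀ {m n} (f : Hom m n), comp (id m) f = f
  comp_id : ∀ {m n} (f : Hom m n), comp f (id n) = f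
  assoc : ∀ {k l m n} (f : Hom k l) (g : Hom l m) (h : Hom m n),
    comp (comp f g) h = comp f (comp g h)
  map : ∀ {m n}, (Fin n → Fin m) → Hom m n
  map_id : ∀ n, map (fun i : Fin n => i) = id n
  map_comp : ∀ {l m n} (f : Fin m → Fin l) (g : Fin n → Fin m),
    map (fun i => f (g i)) = comp (map f) (map g)

namespace PreLawvereTheory

/-- The objects of the category underlying a (pre-)Lawvere theory: natural numbers. -/
structure Obj (T : PreLawvereTheory.{u}) where
  len : ℕ

instance (T : PreLawvereTheory.{u}) : Category.{u} T.Obj where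
  Hom m n := T.Hom m.len n.len
  id m := T.id m.len
  comp f g := T.comp f g
  id_comp := T.id_comp
  comp_id := T.comp_id
  assoc := T.assoc

/-- The identity-on-objects functor `L : Fᵒᵖ ⥤ 𝓛`. -/
def functor (T : PreLawvereTheory.{u}) : FinCardᵒᵖ ⥤ T.Obj where
  obj n := ⟨n.unop.len⟩
  map f := T.map f.unop
  map_id n := T.map_id n.unop.len
  map_comp f g := T.map_comp f.unop g.unop

end PreLawvereTheory

/-- A Lawvere theory: an identity-on-objects functor `L : Fᵒᵖ ⥤ 𝓛` that preserves finite
products. -/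
structure LawvereTheory extends PreLawvereTheory.{u} where
  preserves : PreservesFiniteProducts toPreLawvereTheory.functor

namespace LawvereTheory

/-- A morphism of Lawvere theories `(𝓛, L) ⟶ (𝓛', L')`: a functor `G : 𝓛 ⥤ 𝓛'` with `G ∘ L = L'`.
Such a `G` is necessarily the identity on objects, so it is given by its action on morphisms. -/
@[ext]
structure Mor (T T' : LawvereTheory.{u}) where
  app : ∀ {m n}, T.Hom m n → T'.Hom m n
  app_comp : ∀ {l m n} (f : T.Hom l m) (g : T.Hom m n),
    app (T.comp f g) = T'.comp (app f) (app g)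
  app_map : ∀ {m n} (f : Fin n → Fin m), app (T.map f) = T'.map f

/-- The functor underlying a morphism of Lawvere theories. -/
def Mor.functor {T T' : LawvereTheory.{u}} (G : Mor T T') :
    T.toPreLawvereTheory.Obj ⥤ T'.toPreLawvereTheory.Obj where
  obj n := ⟨n.len⟩
  map f := G.app f
  map_id n := by
    change G.app (T.id n.len) = T'.id n.len
    rw [← T.map_id, G.app_map, T'.map_id]
  map_comp f g := G.app_comp f g

theorem Mor.comp_functor {T T' : LawvereTheory.{u}} (G : Mor T T') :
    T.toPreLawvereTheory.functor ⋙ G.functor = T'.toPreLawvereTheory.functor :=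
  CategoryTheory.Functor.ext (fun _ => rfl) (fun _ _ f =>
    (G.app_map f.unop).trans ((T'.id_comp _).trans (T'.comp_id _)).symm)

instance : Category.{u} LawvereTheory.{u} where
  Hom := Mor
  id T := ⟨fun f => f, fun _ _ => rfl, fun _ => rfl⟩
  comp G H := ⟨fun f => H.app (G.app f),
    fun f g => by rw [G.app_comp, H.app_comp],
    fun f => by rw [G.app_map, H.app_map]⟩

/-- The covariant presheaf `n ↦ 𝓛(n, 1)` on `F` of operations of a Lawvere theory; a function
`f : m ⟶ n` acts as precomposition with `L f : n ⟶ m`. -/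
def operations : LawvereTheory.{u} ⥤ (FinCard ⥤ Type u) where
  obj T := T.toPreLawvereTheory.functor.rightOp ⋙ yoneda.obj ⟨1⟩
  map {T T'} G :=
    { app := fun n => TypeCat.ofHom fun t => (Mor.app G t : T'.Hom n.len 1)
      naturality := fun m n f => by
        ext t
        change Mor.app G (T.comp (T.map f) t) = T'.comp (T'.map f) (Mor.app G t)
        exact (Mor.app_comp G _ _).trans (congrArg (fun k => T'.comp k _) (Mor.app_map G f)) }

end LawvereTheory

/-! ## Substitution algebras for an exponentiation monad -/

section Cartesian

variable {C : Type u} [Category.{v} C] [CartesianMonoidalCategory C] [MonoidalClosed C]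

/-- Exchange of the first two factors: `(x, (y, z)) ↦ (y, (x, z))`. -/
def exch (X Y Z : C) : X ⊗ (Y ⊗ Z) ⟶ Y ⊗ (X ⊗ Z) :=
  lift (snd X (Y ⊗ Z) ≫ fst Y Z) (X ◁ snd Y Z)

namespace ExpMonad

/-! The symmetric monad `T = (-)^V` on a cartesian closed category, induced by the canonical
symmetric comonoid structure (projection, diagonal, symmetry) of `V`, with its canonical
cartesian-monoidal structure. Here `V ⟹ X` is the exponential `X^V`. -/

variable (V : C)

/-- The multiplication `T T X ⟶ T X`, `φ ↦ (a ↦ φ a a)`. -/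
def mu (X : C) : (V ⟹ V ⟹ X) ⟶ (V ⟹ X) :=
  curry (lift (fst V (V ⟹ V ⟹ X)) ((ihom.ev V).app (V ⟹ X)) ≫ (ihom.ev V).app X)

/-- The unit `X ⟶ T X`, `x ↦ (a ↦ x)`. -/
def eta (X : C) : X ⟶ (V ⟹ X) :=
  curry (snd V X)

/-- The symmetry `T T X ⟶ T T X`, `φ ↦ (a ↦ (b ↦ φ b a))`. -/
def sigma (X : C) : (V ⟹ V ⟹ X) ⟶ (V ⟹ V ⟹ X) :=
  curry (curry (exch V V (V ⟹ V ⟹ X) ≫ V ◁ (ihom.ev V).app (V ⟹ X) ≫ (ihom.ev V).app X))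

/-- The monoidal structure `T X × T Y ⟶ T (X × Y)`, `(φ, ψ) ↦ (a ↦ (φ a, ψ a))`. -/
def ell (X Y : C) : (V ⟹ X) ⊗ (V ⟹ Y) ⟶ (V ⟹ X ⊗ Y) :=
  curry (lift (V ◁ fst (V ⟹ X) (V ⟹ Y) ≫ (ihom.ev V).app X)
    (V ◁ snd (V ⟹ X) (V ⟹ Y) ≫ (ihom.ev V).app Y))

/-- The inverse `T (X × Y) ⟶ T X × T Y` of `ell`. -/
def ellInv (X Y : C) : (V ⟹ X ⊗ Y) ⟶ (V ⟹ X) ⊗ (V ⟹ Y) :=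
  lift ((ihom V).map (fst X Y)) ((ihom V).map (snd X Y))

theorem ellInv_comp_ell (X Y : C) : ellInv V X Y ≫ ell V X Y = 𝟙 _ := by
  apply uncurry_injective
  rw [uncurry_natural_left, ell, uncurry_curry]
  ext
  · simp [ellInv, uncurry_eq, ← MonoidalCategory.whiskerLeft_comp_assoc]
  · simp [ellInv, uncurry_eq, ← MonoidalCategory.whiskerLeft_comp_assoc]

theorem ell_comp_ellInv (X Y : C) : ell V X Y ≫ ellInv V X Y = 𝟙 _ := by
  ext
  · apply uncurry_injective
    simp [ellInv, ell, ← curry_natural_right, uncurry_eq]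
  · apply uncurry_injective
    simp [ellInv, ell, ← curry_natural_right, uncurry_eq]

/-- The tensorial strength `T X × Y ⟶ T (X × Y)`. -/
def str (X Y : C) : (V ⟹ X) ⊗ Y ⟶ (V ⟹ X ⊗ Y) :=
  (V ⟹ X) ◁ eta V Y ≫ ell V X Y

/-- `T^• X = T X × X` on objects. -/
abbrev bullet (X : C) : C := (V ⟹ X) ⊗ X

/-- `T^•` on morphisms. -/
abbrev bulletMap {X Y : C} (f : X ⟶ Y) : bullet V X ⟶ bullet V Y := (ihom V).map f ⊗ₘ f

/-- The strength `T^• X × Y ⟶ T^• (X × Y)`, `((φ, x), y) ↦ (str (φ, y), (x, y))`. -/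
def strBullet (X Y : C) : bullet V X ⊗ Y ⟶ bullet V (X ⊗ Y) :=
  lift (fst (V ⟹ X) X ▷ Y ≫ str V X Y) (snd (V ⟹ X) X ▷ Y)

/-- The symmetric distributive law `T T^• X ⟶ T^• T X`. -/
def sigmaBullet (X : C) : (V ⟹ bullet V X) ⟶ bullet V (V ⟹ X) :=
  ellInv V (V ⟹ X) X ≫ sigma V X ▷ (V ⟹ X)

end ExpMonad

open ExpMonad

/-- A substitution algebra for the cartesian-monoidal symmetric monad `T = (-)^V`. -/
structure SubstAlg (V : C) where
  carrier : C
  s : (V ⟹ carrier) ⊗ carrier ⟶ carrier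
  v : 𝟙_ C ⟶ (V ⟹ carrier)
  left_var : v ▷ carrier ≫ s = snd (𝟙_ C) carrier
  contract : (V ⟹ V ⟹ carrier) ◁ v ≫ ell V (V ⟹ carrier) carrier ≫ (ihom V).map s =
    fst (V ⟹ V ⟹ carrier) (𝟙_ C) ≫ mu V carrier
  weaken : eta V carrier ▷ carrier ≫ s = fst carrier carrier
  assoc : sigmaBullet V carrier ▷ carrier ≫ strBullet V (V ⟹ carrier) carrier ≫
      bulletMap V s ≫ s =
    (ihom V).map s ▷ carrier ≫ s

namespace SubstAlg

variable {V : C}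

/-- A homomorphism of substitution algebras. -/
@[ext]
structure Hom (A B : SubstAlg V) where
  hom : A.carrier ⟶ B.carrier
  v_hom : A.v ≫ (ihom V).map hom = B.v
  s_hom : A.s ≫ hom = bulletMap V hom ≫ B.s

instance : Category.{v} (SubstAlg V) where
  Hom := Hom
  id A := ⟨𝟙 _, by simp, by simp⟩
  comp f g := ⟨f.hom ≫ g.hom,
    by rw [Functor.map_comp, ← Category.assoc, f.v_hom, g.v_hom],
    by rw [← Category.assoc, f.s_hom, Category.assoc, g.s_hom]; simp [bulletMap]⟩

/-- The forgetful functor from substitution algebras. -/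
def forget (V : C) : SubstAlg V ⥤ C where
  obj A := A.carrier
  map f := Hom.hom f

end SubstAlg

/-! ## Algebraic presentations with arities and coarities -/

/-- Exchange of arguments: `(X ⟶ A^Y)` to `(Y ⟶ A^X)`. -/
def flipArg {X Y A : C} (f : X ⟶ (Y ⟹ A)) : Y ⟶ (X ⟹ A) :=
  curry (lift (snd X Y) (fst X Y) ≫ uncurry f)

/-- The canonical map `A^(R × P) ⟶ (A^P)^R`. -/
def expCurry (R P A : C) : (R ⊗ P ⟹ A) ⟶ (R ⟹ P ⟹ A) :=
  curry (curry (exch P R (R ⊗ P ⟹ A) ≫ (α_ R P (R ⊗ P ⟹ A)).inv ≫ (ihom.ev (R ⊗ P)).app A))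

/-- The canonical map `(A^P)^R ⟶ A^(R × P)`. -/
def expUncurry (R P A : C) : (R ⟹ P ⟹ A) ⟶ (R ⊗ P ⟹ A) :=
  curry ((α_ R P (R ⟹ P ⟹ A)).hom ≫ exch R P (R ⟹ P ⟹ A) ≫
    P ◁ (ihom.ev R).app (P ⟹ A) ≫ (ihom.ev P).app A)

variable [HasBinaryCoproducts C]

/-- The canonical (distributivity) map `R × (P + Q) ⟶ R × P + R × Q`. -/
def distr (R P Q : C) : R ⊗ (P ⨿ Q) ⟶ (R ⊗ P) ⨿ (R ⊗ Q) :=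
  uncurry (coprod.desc (curry coprod.inl) (curry coprod.inr))

/-- A signature: a set of operators, each with an arity `P` and a coarity `Q` that are objects of
`C`; such an operator is to be interpreted as a morphism `A^P ⟶ A^Q`. -/
structure CatSig (C : Type u) where
  Op : Type
  ar : Op → C
  coar : Op → C

/-- Terms of a signature, of given arity and coarity: they are generated from the operators by
change of variables, composition, (co)pairing of coarities and parameterization. -/
inductive CatTerm (S : CatSig C) : C → C → Type (max u v)
  | op (o : S.Op) : CatTerm S (S.ar o) (S.coar o)
  | var {P Q : C} (f : Q ⟶ P) : CatTerm S P Q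
  | comp {P Q R : C} (t : CatTerm S P Q) (t' : CatTerm S Q R) : CatTerm S P R
  | pair {P Q R : C} (t : CatTerm S P Q) (t' : CatTerm S P R) : CatTerm S P (Q ⨿ R)
  | param (R : C) {P Q : C} (t : CatTerm S P Q) : CatTerm S (R ⊗ P) (R ⊗ Q)

/-- A structure for a signature. -/
structure CatStr (S : CatSig C) where
  carrier : C
  op : ∀ o : S.Op, (S.ar o ⟹ carrier) ⟶ (S.coar o ⟹ carrier)

/-- The interpretation `A^P ⟶ A^Q` of a term of arity `P` and coarity `Q`. -/
def CatTerm.interp {S : CatSig C} (A : CatStr S) :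
    ∀ {P Q : C}, CatTerm S P Q → ((P ⟹ A.carrier) ⟶ (Q ⟹ A.carrier))
  | _, _, .op o => A.op o
  | _, _, .var f => (MonoidalClosed.pre f).app A.carrier
  | _, _, .comp t t' => t.interp A ≫ t'.interp A
  | _, _, .pair t t' => flipArg (coprod.desc (flipArg (t.interp A)) (flipArg (t'.interp A)))
  | _, _, .param (P := P) (Q := Q) R t =>
      expCurry R P A.carrier ≫ (ihom R).map (t.interp A) ≫ expUncurry R Q A.carrier

variable (C) in
/-- An algebraic presentation: a signature and a set of equations between terms. -/
structure CatPres where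
  sig : CatSig C
  Eqn : Type
  src : Eqn → C
  tgt : Eqn → C
  lhs : ∀ e, CatTerm sig (src e) (tgt e)
  rhs : ∀ e, CatTerm sig (src e) (tgt e)

/-- An algebra of a presentation: a structure that satisfies its equations. -/
structure CatPres.Alg (P : CatPres C) extends CatStr P.sig where
  eqn : ∀ e : P.Eqn, (P.lhs e).interp toCatStr = (P.rhs e).interp toCatStr

namespace CatPres.Alg

variable {P : CatPres C}

/-- A homomorphism of algebras of a presentation. -/
@[ext]
structure Hom (A B : P.Alg) where
  hom : A.carrier ⟶ B.carrier
  op_hom : ∀ o : P.sig.Op,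
    A.op o ≫ (ihom (P.sig.coar o)).map hom = (ihom (P.sig.ar o)).map hom ≫ B.op o

instance : Category.{v} P.Alg where
  Hom := Hom
  id A := ⟨𝟙 _, fun o => by simp⟩
  comp f g := ⟨f.hom ≫ g.hom, fun o => by
    rw [Functor.map_comp, ← Category.assoc, f.op_hom, Category.assoc, g.op_hom]; simp⟩

/-- The forgetful functor from algebras of a presentation. -/
def forget (P : CatPres C) : P.Alg ⥤ C where
  obj A := A.carrier
  map f := Hom.hom f

end CatPres.Alg

/-! ## The theory of substitution -/

/-- The two operators of the theory of substitution. -/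
inductive SubstOp
  | subst
  | var

/-- The four equations of the theory of substitution. -/
inductive SubstEqn
  | leftVar
  | contract
  | weaken
  | assoc

variable [HasInitial C]

/-- The signature of the theory of substitution: `subst` has arity `V + 1` and coarity `1`,
and `var` has arity `0` and coarity `V`. -/
def substSig (V : C) : CatSig C where
  Op := SubstOp
  ar | .subst => V ⨿ 𝟙_ C | .var => ⊥_ C
  coar | .subst => 𝟙_ C | .var => V

namespace SubstTerm

variable {V : C} {G : C}

/-- The generic variable, in context `G`. -/
def gvar : CatTerm (substSig V) G V :=
  .comp (.var (initial.to G)) (.op (S := substSig V) SubstOp.var)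

/-- The substitution `t[u]` of `u : A` in `t : A^V`. -/
def sub (t : CatTerm (substSig V) G V) (u : CatTerm (substSig V) G (𝟙_ C)) :
    CatTerm (substSig V) G (𝟙_ C) :=
  .comp (.pair t u) (.op (S := substSig V) SubstOp.subst)

/-- Substitution under a parameter `a : V`: from `t : (A^V)^V` and `u : A^V` form
`a ↦ (t a)[u a]`. -/
def subUnder (t : CatTerm (substSig V) G (V ⊗ V)) (u : CatTerm (substSig V) G V) :
    CatTerm (substSig V) G V :=
  .comp (.comp (.comp
    (.pair t (.comp u (.var (ρ_ V).hom)))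
    (.var (distr V V (𝟙_ C))))
    (.param V (.op (S := substSig V) SubstOp.subst)))
    (.var (ρ_ V).inv)

end SubstTerm

open SubstTerm in
/-- The theory of substitution, with two operators and four equations:
* `x : A ⊢ var[x] = x`;
* `x : (A^V)^V ⊢ (a ↦ (x a)[var a]) = (a ↦ x a a) : A^V`;
* `x : A, y : A ⊢ (a ↦ x)[y] = x`;
* `x : (A^V)^V, y : A^V, z : A ⊢ (a ↦ (x a)[y a])[z] = (b ↦ (a ↦ x a b)[z])[y[z]]`. -/
def substTheory (V : C) : CatPres C where
  sig := substSig V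
  Eqn := SubstEqn
  src
    | .leftVar => 𝟙_ C
    | .contract => V ⊗ V
    | .weaken => 𝟙_ C ⨿ 𝟙_ C
    | .assoc => ((V ⊗ V) ⨿ V) ⨿ 𝟙_ C
  tgt
    | .leftVar => 𝟙_ C
    | .contract => V
    | .weaken => 𝟙_ C
    | .assoc => 𝟙_ C
  lhs
    | .leftVar => sub gvar (.var (𝟙 _))
    | .contract => subUnder (.var (𝟙 _)) gvar
    | .weaken => sub (.var (toUnit V ≫ coprod.inl)) (.var coprod.inr)
    | .assoc =>
        sub (subUnder (.var (coprod.inl ≫ coprod.inl)) (.var (coprod.inr ≫ coprod.inl)))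
          (.var coprod.inr)
  rhs
    | .leftVar => .var (𝟙 _)
    | .contract => .var (lift (𝟙 V) (𝟙 V))
    | .weaken => .var coprod.inl
    | .assoc =>
        sub
          (subUnder (.var (lift (snd V V) (fst V V) ≫ coprod.inl ≫ coprod.inl))
            (.var (toUnit V ≫ coprod.inr)))
          (sub (.var (coprod.inr ≫ coprod.inl)) (.var coprod.inr))

end Cartesian

/-! ## The object-classifier topos -/

/-- The universal object model `V = F(1, -)` in `Set^F`. -/
def universalObject : FinCard ⥤ Type u :=
  uliftCoyoneda.{u}.obj (Opposite.op (FinCard.mk 1))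

end

noncomputable section

/-! ## Morphisms between exponentials through generalized elements -/

section Cartesian

variable {C : Type u} [Category.{v} C] [CartesianMonoidalCategory C] [MonoidalClosed C]

open ExpMonad

/-- The action of `f : A^P ⟶ A^Q` on elements of `A^P` at stage `X`. -/
def transpose {P Q A B : C} (f : (P ⟹ A) ⟶ (Q ⟹ B)) {X : C} (φ : P ⊗ X ⟶ A) : Q ⊗ X ⟶ B :=
  uncurry (curry φ ≫ f)

theorem transpose_ext {P Q A B : C} {f g : (P ⟹ A) ⟶ (Q ⟹ B)}
    (h : ∀ (X : C) (φ : P ⊗ X ⟶ A), transpose f φ = transpose g φ) : f = g := by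
  have h' := h _ (uncurry (𝟙 (P ⟹ A)))
  simp only [transpose, curry_uncurry, Category.id_comp] at h'
  exact uncurry_injective h'

theorem transpose_comp {P Q R A B D : C} (f : (P ⟹ A) ⟶ (Q ⟹ B)) (g : (Q ⟹ B) ⟶ (R ⟹ D)) {X : C}
    (φ : P ⊗ X ⟶ A) : transpose (f ≫ g) φ = transpose g (transpose f φ) := by
  simp [transpose]

theorem transpose_map (P : C) {A B : C} (h : A ⟶ B) {X : C} (φ : P ⊗ X ⟶ A) :
    transpose ((ihom P).map h) φ = φ ≫ h := by
  rw [transpose, uncurry_natural_right, uncurry_curry]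

theorem transpose_pre {P Q : C} (f : Q ⟶ P) (A : C) {X : C} (φ : P ⊗ X ⟶ A) :
    transpose ((MonoidalClosed.pre f).app A) φ = f ▷ X ≫ φ := by
  simp [transpose, curry_pre_app]

/-- The canonical map `X ⟶ 1 × X`. -/
abbrev unitLift (X : C) : X ⟶ 𝟙_ C ⊗ X := lift (toUnit X) (𝟙 X)

omit [MonoidalClosed C] in
theorem snd_unitLift (X : C) : snd (𝟙_ C) X ≫ unitLift X = 𝟙 _ := by
  ext
  simp

omit [MonoidalClosed C] in
theorem whiskerLeft_unitLift {X Y : C} (h : X ⟶ Y) : unitLift X ≫ 𝟙_ C ◁ h = h ≫ unitLift Y := by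
  ext
  simp

omit [MonoidalClosed C] in
theorem exch_exch (X Y Z : C) : exch X Y Z ≫ exch Y X Z = 𝟙 _ := by
  ext <;> simp [exch]

omit [MonoidalClosed C] in
theorem exch_natural {P R X Y : C} (f : X ⟶ Y) :
    P ◁ R ◁ f ≫ exch P R Y = exch P R X ≫ R ◁ P ◁ f := by
  ext <;> simp [exch]

theorem transpose_expCurry (R P A : C) {X : C} (φ : (R ⊗ P) ⊗ X ⟶ A) :
    transpose (expCurry R P A) φ = curry (exch P R X ≫ (α_ R P X).inv ≫ φ) := by
  apply uncurry_injective
  rw [transpose, expCurry, ← curry_natural_left, uncurry_curry, ← curry_natural_left,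
    uncurry_curry, uncurry_curry, ← Category.assoc, exch_natural, Category.assoc]
  congr 1
  rw [associator_inv_naturality_right_assoc, ← uncurry_eq, uncurry_curry]

theorem transpose_expUncurry (R P A : C) {X : C} (ψ : R ⊗ X ⟶ (P ⟹ A)) :
    transpose (expUncurry R P A) ψ = (α_ R P X).hom ≫ exch R P X ≫ uncurry ψ := by
  rw [transpose, expUncurry, ← curry_natural_left, uncurry_curry,
    associator_naturality_right_assoc, ← Category.assoc (R ◁ P ◁ curry ψ), exch_natural,
    Category.assoc, ← Category.assoc (P ◁ R ◁ curry ψ), ← MonoidalCategory.whiskerLeft_comp, whiskerLeft_curry_ihom_ev_app,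
    ← uncurry_eq]

/-- The copairing `(P + Q) × X ⟶ A` of two morphisms. -/
def copair [HasBinaryCoproducts C] {P Q X A : C} (f : P ⊗ X ⟶ A) (g : Q ⊗ X ⟶ A) :
    (P ⨿ Q) ⊗ X ⟶ A :=
  lift (snd (P ⨿ Q) X) (fst (P ⨿ Q) X) ≫
    uncurry (coprod.desc (curry (lift (snd X P) (fst X P) ≫ f))
      (curry (lift (snd X Q) (fst X Q) ≫ g)))

theorem whiskerRight_swap_uncurry {P Q X A : C} (i : P ⟶ Q) (f : Q ⟶ (X ⟹ A)) :
    i ▷ X ≫ lift (snd Q X) (fst Q X) ≫ uncurry f =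
      lift (snd P X) (fst P X) ≫ uncurry (i ≫ f) := by
  rw [uncurry_natural_left]
  simp only [← Category.assoc]
  congr 1
  ext <;> simp

omit [MonoidalClosed C] in
theorem swap_swap_assoc {X P Z : C} (f : P ⊗ X ⟶ Z) :
    lift (snd P X) (fst P X) ≫ lift (snd X P) (fst X P) ≫ f = f := by
  rw [← Category.assoc]
  convert Category.id_comp f
  ext <;> simp

section

variable [HasBinaryCoproducts C]

theorem inl_copair {P Q X A : C} (f : P ⊗ X ⟶ A) (g : Q ⊗ X ⟶ A) :
    (coprod.inl : P ⟶ P ⨿ Q) ▷ X ≫ copair f g = f := by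
  rw [copair, whiskerRight_swap_uncurry, coprod.inl_desc, uncurry_curry, swap_swap_assoc]

theorem inr_copair {P Q X A : C} (f : P ⊗ X ⟶ A) (g : Q ⊗ X ⟶ A) :
    (coprod.inr : Q ⟶ P ⨿ Q) ▷ X ≫ copair f g = g := by
  rw [copair, whiskerRight_swap_uncurry, coprod.inr_desc, uncurry_curry, swap_swap_assoc]

theorem copair_ext {P Q X A : C} {f g : (P ⨿ Q) ⊗ X ⟶ A}
    (hl : (coprod.inl : P ⟶ P ⨿ Q) ▷ X ≫ f = (coprod.inl : P ⟶ P ⨿ Q) ▷ X ≫ g)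
    (hr : (coprod.inr : Q ⟶ P ⨿ Q) ▷ X ≫ f = (coprod.inr : Q ⟶ P ⨿ Q) ▷ X ≫ g) : f = g := by
  have key : ∀ f : (P ⨿ Q) ⊗ X ⟶ A,
      f = lift (snd (P ⨿ Q) X) (fst (P ⨿ Q) X) ≫
        uncurry (curry (lift (snd X (P ⨿ Q)) (fst X (P ⨿ Q)) ≫ f)) := fun f => by
    rw [uncurry_curry, swap_swap_assoc]
  have key' : ∀ {P Q : C} (i : P ⟶ Q) (f : Q ⊗ X ⟶ A),
      i ≫ curry (lift (snd X Q) (fst X Q) ≫ f) =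
        curry (lift (snd X P) (fst X P) ≫ i ▷ X ≫ f) := fun {P Q} i f => by
    rw [← curry_natural_left]
    congr 1
    simp only [← Category.assoc]
    congr 1
    ext <;> simp
  rw [key f, key g]
  congr 2
  apply coprod.hom_ext
  · rw [key', key', hl]
  · rw [key', key', hr]

variable {S : CatSig C} (B : CatStr S)

namespace CatTerm

theorem transpose_var {P Q : C} (f : Q ⟶ P) {X : C} (φ : P ⊗ X ⟶ B.carrier) :
    transpose ((CatTerm.var (S := S) f).interp B) φ = f ▷ X ≫ φ :=
  transpose_pre _ _ _

theorem transpose_comp {P Q R : C} (t : CatTerm S P Q) (t' : CatTerm S Q R) {X : C}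
    (φ : P ⊗ X ⟶ B.carrier) :
    transpose ((t.comp t').interp B) φ = transpose (t'.interp B) (transpose (t.interp B) φ) :=
  _root_.transpose_comp _ _ _

theorem transpose_pair {P Q R : C} (t : CatTerm S P Q) (t' : CatTerm S P R) {X : C}
    (φ : P ⊗ X ⟶ B.carrier) :
    transpose ((t.pair t').interp B) φ =
      copair (transpose (t.interp B) φ) (transpose (t'.interp B) φ) := by
  have key : ∀ {Q' : C} (g : Q' ⟶ ((P ⟹ B.carrier) ⟹ B.carrier)),
      transpose (flipArg g) φ =
        Q' ◁ curry φ ≫ lift (snd Q' (P ⟹ B.carrier)) (fst Q' (P ⟹ B.carrier)) ≫ uncurry g := by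
    intro Q' g
    rw [transpose, flipArg, ← curry_natural_left, uncurry_curry]
  have key' : ∀ {Q' : C} (f : (P ⟹ B.carrier) ⟶ (Q' ⟹ B.carrier)),
      Q' ◁ curry φ ≫ lift (snd Q' (P ⟹ B.carrier)) (fst Q' (P ⟹ B.carrier)) ≫
        uncurry (flipArg f) = transpose f φ := by
    intro Q' f
    rw [flipArg, uncurry_curry, swap_swap_assoc, ← uncurry_natural_left, transpose]
  apply copair_ext
  · rw [inl_copair, CatTerm.interp, key, ← whisker_exchange_assoc, whiskerRight_swap_uncurry,
      coprod.inl_desc, key']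
  · rw [inr_copair, CatTerm.interp, key, ← whisker_exchange_assoc, whiskerRight_swap_uncurry,
      coprod.inr_desc, key']

theorem transpose_param (R : C) {P Q : C} (t : CatTerm S P Q) {X : C}
    (φ : (R ⊗ P) ⊗ X ⟶ B.carrier) :
    transpose ((t.param R).interp B) φ = (α_ R Q X).hom ≫ exch R Q X ≫
      transpose (t.interp B) (exch P R X ≫ (α_ R P X).inv ≫ φ) := by
  rw [CatTerm.interp, _root_.transpose_comp, _root_.transpose_comp, transpose_expCurry,
    transpose_map, transpose_expUncurry]
  rfl

end CatTerm

end

end Cartesian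

/-! ## Substitution algebras through generalized elements -/

section Cartesian

variable {C : Type u} [Category.{v} C] [CartesianMonoidalCategory C] [MonoidalClosed C]

open ExpMonad

/-- Substitution of `u : A` in `f : A^V` at stage `X`. -/
def substAt {V A : C} (s : (V ⟹ A) ⊗ A ⟶ A) {X : C} (f : V ⊗ X ⟶ A) (u : X ⟶ A) : X ⟶ A :=
  lift (curry f) u ≫ s

theorem substAt_natural {V A : C} (s : (V ⟹ A) ⊗ A ⟶ A) {X Y : C} (h : Y ⟶ X) (f : V ⊗ X ⟶ A)
    (u : X ⟶ A) : h ≫ substAt s f u = substAt s (V ◁ h ≫ f) (h ≫ u) := by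
  simp [substAt, curry_natural_left, ← Category.assoc]

theorem comp_eq_substAt {V A : C} (s : (V ⟹ A) ⊗ A ⟶ A) {X : C} (f : X ⟶ (V ⟹ A) ⊗ A) :
    f ≫ s = substAt s (uncurry (f ≫ fst _ _)) (f ≫ snd _ _) := by
  rw [substAt, curry_uncurry]
  congr 1
  ext <;> simp

theorem prod_hom_ext {V A B D : C} {f g : (V ⟹ A) ⊗ B ⟶ D}
    (h : ∀ (X : C) (x : V ⊗ X ⟶ A) (y : X ⟶ B), lift (curry x) y ≫ f = lift (curry x) y ≫ g) :
    f = g := by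
  have := h _ (uncurry (fst _ _)) (snd _ _)
  rwa [curry_uncurry, lift_fst_snd, Category.id_comp, Category.id_comp] at this

/-- The four axioms of substitution algebras for generalized elements. The generic variable
is given as `V ⟶ A`. -/
structure IsSubst {V A : C} (s : (V ⟹ A) ⊗ A ⟶ A) (w : V ⟶ A) : Prop where
  left_var : ∀ {X : C} (x : X ⟶ A), substAt s (fst V X ≫ w) x = x
  contract : ∀ {X : C} (x : V ⊗ V ⊗ X ⟶ A),
    substAt s x (fst V X ≫ w) = lift (fst V X) (𝟙 (V ⊗ X)) ≫ x
  weaken : ∀ {X : C} (x y : X ⟶ A), substAt s (snd V X ≫ x) y = x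
  assoc : ∀ {X : C} (x : V ⊗ V ⊗ X ⟶ A) (y : V ⊗ X ⟶ A) (z : X ⟶ A),
    substAt s (substAt s x y) z =
      substAt s (substAt s (exch V V X ≫ x) (snd V X ≫ z)) (substAt s y z)

/-- The generic variable as a morphism `V ⟶ A`. -/
def genVar {V A : C} (v : 𝟙_ C ⟶ (V ⟹ A)) : V ⟶ A :=
  (ρ_ V).inv ≫ uncurry v

theorem toUnit_genVar {V A : C} (v : 𝟙_ C ⟶ (V ⟹ A)) (X : C) :
    toUnit X ≫ v = curry (fst V X ≫ genVar v) := by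
  apply uncurry_injective
  rw [uncurry_curry, uncurry_natural_left, genVar, ← Category.assoc]
  congr 1
  ext; simp

theorem fst_genVar_uncurry {V A : C} (v : 𝟙_ C ⟶ (V ⟹ A)) {X : C} (h : X ⟶ 𝟙_ C) :
    uncurry (h ≫ v) = fst V X ≫ genVar v := by
  rw [toUnit_unique h (toUnit X), toUnit_genVar, uncurry_curry]

section axioms

variable {V A : C} (s : (V ⟹ A) ⊗ A ⟶ A) (v : 𝟙_ C ⟶ (V ⟹ A))

theorem left_var_iff : v ▷ A ≫ s = snd (𝟙_ C) A ↔
    ∀ {X : C} (x : X ⟶ A), substAt s (fst V X ≫ genVar v) x = x := by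
  constructor
  · intro h X x
    have := lift (toUnit X) x ≫= h
    rwa [lift_snd, lift_whiskerRight_assoc, toUnit_genVar] at this
  · intro h
    rw [comp_eq_substAt]
    simpa [fst_genVar_uncurry] using h (snd (𝟙_ C) A)

theorem weaken_iff : eta V A ▷ A ≫ s = fst A A ↔
    ∀ {X : C} (x y : X ⟶ A), substAt s (snd V X ≫ x) y = x := by
  constructor
  · intro h X x y
    have := lift x y ≫= h
    rwa [lift_fst, lift_whiskerRight_assoc, eta, ← curry_natural_left, whiskerLeft_snd] at this
  · intro h
    rw [comp_eq_substAt]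
    simpa [eta, uncurry_natural_left] using h (fst A A) (snd A A)

theorem lift_ell {X P Q : C} (f : V ⊗ X ⟶ P) (g : V ⊗ X ⟶ Q) :
    lift (curry f) (curry g) ≫ ell V P Q = curry (lift f g) := by
  rw [ell, ← curry_natural_left]
  congr 1
  ext
  · simp [← uncurry_eq, ← uncurry_natural_left]
  · simp [← uncurry_eq, ← uncurry_natural_left]

theorem curry_mu {X A : C} (x : V ⊗ V ⊗ X ⟶ A) :
    curry (curry x) ≫ mu V A = curry (lift (fst V X) (𝟙 (V ⊗ X)) ≫ x) := by
  rw [mu, ← curry_natural_left]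
  congr 1
  have : V ◁ curry (curry x) ≫ lift (fst V (V ⟹ V ⟹ A)) ((ihom.ev V).app (V ⟹ A)) =
      lift (fst V X) (𝟙 (V ⊗ X)) ≫ V ◁ curry x := by
    ext <;> simp [whiskerLeft_curry_ihom_ev_app]
  rw [reassoc_of% this, whiskerLeft_curry_ihom_ev_app]

theorem curry_sigma {X A : C} (x : V ⊗ V ⊗ X ⟶ A) :
    curry (curry x) ≫ sigma V A = curry (curry (exch V V X ≫ x)) := by
  rw [sigma, ← curry_natural_left, ← curry_natural_left, ← Category.assoc, exch_natural,
    Category.assoc, ← whiskerLeft_comp_assoc, whiskerLeft_curry_ihom_ev_app,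
    whiskerLeft_curry_ihom_ev_app]

theorem contract_iff : (V ⟹ V ⟹ A) ◁ v ≫ ell V (V ⟹ A) A ≫ (ihom V).map s =
      fst (V ⟹ V ⟹ A) (𝟙_ C) ≫ mu V A ↔
    ∀ {X : C} (x : V ⊗ V ⊗ X ⟶ A),
      substAt s x (fst V X ≫ genVar v) = lift (fst V X) (𝟙 (V ⊗ X)) ≫ x := by
  have key : ∀ {X : C} (x : V ⊗ V ⊗ X ⟶ A), lift (curry (curry x)) (toUnit X) ≫
      (V ⟹ V ⟹ A) ◁ v ≫ ell V (V ⟹ A) A ≫ (ihom V).map s =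
        curry (substAt s x (fst V X ≫ genVar v)) := fun {X} x => by
    rw [lift_whiskerLeft_assoc, toUnit_genVar, ← Category.assoc, lift_ell, ← curry_natural_right]
    rfl
  constructor
  · intro h X x
    have := lift (curry (curry x)) (toUnit X) ≫= h
    rw [key, lift_fst_assoc, curry_mu] at this
    exact curry_injective this
  · intro h
    have h1 := h (uncurry (uncurry (fst (V ⟹ V ⟹ A) (𝟙_ C))))
    apply_fun curry at h1
    rw [← key, ← curry_mu, curry_uncurry, curry_uncurry] at h1
    simpa [toUnit_unique (toUnit _) (snd (V ⟹ V ⟹ A) (𝟙_ C))] using h1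

theorem assoc_iff : sigmaBullet V A ▷ A ≫ strBullet V (V ⟹ A) A ≫ bulletMap V s ≫ s =
      (ihom V).map s ▷ A ≫ s ↔
    ∀ {X : C} (x : V ⊗ V ⊗ X ⟶ A) (y : V ⊗ X ⟶ A) (z : X ⟶ A),
      substAt s (substAt s x y) z =
        substAt s (substAt s (exch V V X ≫ x) (snd V X ≫ z)) (substAt s y z) := by
  have key1 : ∀ {X : C} (x : V ⊗ V ⊗ X ⟶ A) (y : V ⊗ X ⟶ A) (z : X ⟶ A),
      lift (curry (lift (curry x) y)) z ≫ (ihom V).map s ▷ A ≫ s =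
        substAt s (substAt s x y) z := fun {X} x y z => by
    rw [lift_whiskerRight_assoc, ← curry_natural_right]
    rfl
  have key2 : ∀ {X : C} (x : V ⊗ V ⊗ X ⟶ A) (y : V ⊗ X ⟶ A) (z : X ⟶ A),
      lift (curry (lift (curry x) y)) z ≫
        sigmaBullet V A ▷ A ≫ strBullet V (V ⟹ A) A ≫ bulletMap V s ≫ s =
        substAt s (substAt s (exch V V X ≫ x) (snd V X ≫ z)) (substAt s y z) :=
    fun {X} x y z => by
    have e1 : curry (lift (curry x) y) ≫ sigmaBullet V A =
        lift (curry (curry (exch V V X ≫ x))) (curry y) := by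
      rw [sigmaBullet, ellInv, ← Category.assoc, comp_lift, ← curry_natural_right,
        ← curry_natural_right, lift_fst, lift_snd, lift_whiskerRight, curry_sigma]
    have e2 : lift (lift (curry (curry (exch V V X ≫ x))) (curry y)) z ≫
        strBullet V (V ⟹ A) A =
        lift (curry (lift (curry (exch V V X ≫ x)) (snd V X ≫ z))) (lift (curry y) z) := by
      have : z ≫ eta V A = curry (snd V X ≫ z) := by
        rw [eta, ← curry_natural_left, whiskerLeft_snd]
      rw [strBullet, comp_lift, lift_whiskerRight_assoc, lift_fst, lift_whiskerRight, lift_snd,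
        str, lift_whiskerLeft_assoc, this, lift_ell]
    rw [lift_whiskerRight_assoc, e1, reassoc_of% e2, bulletMap, lift_map_assoc,
      ← curry_natural_right]
    rfl
  constructor
  · intro h X x y z
    rw [← key1, ← key2, h]
  · intro h
    have h1 := h (uncurry (uncurry (fst (V ⟹ bullet V A) A) ≫ fst _ _))
      (uncurry (fst (V ⟹ bullet V A) A) ≫ snd _ _) (snd (V ⟹ bullet V A) A)
    rw [← key1, ← key2, curry_uncurry] at h1
    have e : lift (uncurry (fst (V ⟹ bullet V A) A) ≫ fst (V ⟹ A) A)
        (uncurry (fst (V ⟹ bullet V A) A) ≫ snd (V ⟹ A) A) =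
        uncurry (fst (V ⟹ bullet V A) A) := by
      ext <;> simp
    rw [e, curry_uncurry, lift_fst_snd, Category.id_comp, Category.id_comp] at h1
    exact h1.symm

end axioms

theorem SubstAlg.isSubst {V : C} (B : SubstAlg V) : IsSubst B.s (genVar B.v) where
  left_var := (left_var_iff _ _).1 B.left_var
  contract := (contract_iff _ _).1 B.contract
  weaken := (weaken_iff _).1 B.weaken
  assoc := (assoc_iff _).1 B.assoc

/-- A substitution algebra from its structure on generalized elements. -/
def SubstAlg.ofIsSubst {V A : C} (s : (V ⟹ A) ⊗ A ⟶ A) (v : 𝟙_ C ⟶ (V ⟹ A))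
    (h : IsSubst s (genVar v)) : SubstAlg V where
  carrier := A
  s := s
  v := v
  left_var := (left_var_iff _ _).2 h.left_var
  contract := (contract_iff _ _).2 h.contract
  weaken := (weaken_iff _).2 h.weaken
  assoc := (assoc_iff _).2 h.assoc

end Cartesian

/-! ## Algebras of the theory of substitution -/

section Cartesian

variable {C : Type u} [Category.{v} C] [CartesianMonoidalCategory C] [MonoidalClosed C]
  [HasBinaryCoproducts C]

open ExpMonad SubstTerm

theorem inl_distr (R P Q : C) : R ◁ (coprod.inl : P ⟶ P ⨿ Q) ≫ distr R P Q = coprod.inl := by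
  rw [distr, ← uncurry_natural_left, coprod.inl_desc, uncurry_curry]

theorem inr_distr (R P Q : C) : R ◁ (coprod.inr : Q ⟶ P ⨿ Q) ≫ distr R P Q = coprod.inr := by
  rw [distr, ← uncurry_natural_left, coprod.inr_desc, uncurry_curry]

omit [MonoidalClosed C] [HasBinaryCoproducts C] in
theorem whiskerRight_exch_assoc {P Q R X A : C} (i : P ⟶ Q) (f : R ⊗ Q ⊗ X ⟶ A) :
    i ▷ (R ⊗ X) ≫ exch Q R X ≫ f = exch P R X ≫ R ◁ i ▷ X ≫ f := by
  rw [← Category.assoc, ← Category.assoc]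
  congr 1
  ext <;> simp [exch]

variable [HasInitial C] {V : C}

/-- The operator of substitution as a term. -/
def substTerm : CatTerm (substSig V) (V ⨿ 𝟙_ C) (𝟙_ C) := .op (S := substSig V) SubstOp.subst

/-- The operator of the generic variable as a term. -/
def varTerm : CatTerm (substSig V) (⊥_ C) V := .op (S := substSig V) SubstOp.var

omit [MonoidalClosed C] in
theorem gvar_eq {G : C} : (gvar : CatTerm (substSig V) G V) = .comp (.var (initial.to G)) varTerm :=
  rfl

omit [MonoidalClosed C] in
theorem sub_eq {G : C} (t : CatTerm (substSig V) G V) (u : CatTerm (substSig V) G (𝟙_ C)) :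
    sub t u = .comp (.pair t u) substTerm := rfl

theorem subUnder_eq {G : C} (t : CatTerm (substSig V) G (V ⊗ V)) (u : CatTerm (substSig V) G V) :
    subUnder t u = .comp (.comp (.comp (.pair t (.comp u (.var (ρ_ V).hom)))
      (.var (distr V V (𝟙_ C)))) (.param V substTerm)) (.var (ρ_ V).inv) := rfl

/-- The operators of a structure for the signature of substitution are given by the
substitution `s` and by the generic variable `w`. -/
structure Interprets (B : CatStr (substSig V)) (s : (V ⟹ B.carrier) ⊗ B.carrier ⟶ B.carrier)
    (w : V ⟶ B.carrier) : Prop where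
  subst : ∀ {X : C} (φ : (V ⨿ 𝟙_ C) ⊗ X ⟶ B.carrier),
    transpose (substTerm.interp B) φ =
      snd (𝟙_ C) X ≫ substAt s ((coprod.inl : V ⟶ V ⨿ 𝟙_ C) ▷ X ≫ φ)
        (unitLift X ≫ (coprod.inr : 𝟙_ C ⟶ V ⨿ 𝟙_ C) ▷ X ≫ φ)
  var : ∀ {X : C} (φ : (⊥_ C) ⊗ X ⟶ B.carrier), transpose (varTerm.interp B) φ = fst V X ≫ w

namespace Interprets

variable {B : CatStr (substSig V)} {s : (V ⟹ B.carrier) ⊗ B.carrier ⟶ B.carrier}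
  {w : V ⟶ B.carrier} (h : Interprets B s w)
include h

theorem transpose_gvar {G X : C} (φ : G ⊗ X ⟶ B.carrier) :
    transpose (gvar.interp B) φ = fst V X ≫ w := by
  rw [gvar_eq, CatTerm.transpose_comp, h.var]

theorem transpose_sub {G X : C} (t : CatTerm (substSig V) G V)
    (u : CatTerm (substSig V) G (𝟙_ C)) (φ : G ⊗ X ⟶ B.carrier) :
    transpose ((sub t u).interp B) φ = snd (𝟙_ C) X ≫
      substAt s (transpose (t.interp B) φ) (unitLift X ≫ transpose (u.interp B) φ) := by
  rw [sub_eq, CatTerm.transpose_comp, CatTerm.transpose_pair, h.subst, inl_copair, inr_copair]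

theorem transpose_param_subst {X : C} (φ : (V ⊗ (V ⨿ 𝟙_ C)) ⊗ X ⟶ B.carrier) :
    transpose ((CatTerm.param V substTerm).interp B) φ =
      (α_ V (𝟙_ C) X).hom ≫ exch V (𝟙_ C) X ≫ snd (𝟙_ C) (V ⊗ X) ≫
        substAt s (exch V V X ≫ (α_ V V X).inv ≫ (V ◁ coprod.inl) ▷ X ≫ φ)
          (unitLift (V ⊗ X) ≫ exch (𝟙_ C) V X ≫ (α_ V (𝟙_ C) X).inv ≫
            (V ◁ coprod.inr) ▷ X ≫ φ) := by
  rw [CatTerm.transpose_param, h.subst, whiskerRight_exch_assoc, whiskerRight_exch_assoc,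
    associator_inv_naturality_middle_assoc, associator_inv_naturality_middle_assoc]

theorem transpose_subUnder {G X : C} (t : CatTerm (substSig V) G (V ⊗ V))
    (u : CatTerm (substSig V) G V) (φ : G ⊗ X ⟶ B.carrier) :
    transpose ((subUnder t u).interp B) φ =
      substAt s (exch V V X ≫ (α_ V V X).inv ≫ transpose (t.interp B) φ)
        (transpose (u.interp B) φ) := by
  have e1 : (ρ_ V).inv ▷ X ≫ (α_ V (𝟙_ C) X).hom ≫ exch V (𝟙_ C) X ≫ snd (𝟙_ C) (V ⊗ X) =
      𝟙 _ := by
    ext <;> simp [exch]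
  have e2 : unitLift (V ⊗ X) ≫ exch (𝟙_ C) V X ≫ (α_ V (𝟙_ C) X).inv ≫ (ρ_ V).hom ▷ X = 𝟙 _ := by
    ext <;> simp [exch]
  rw [subUnder_eq, CatTerm.transpose_comp, CatTerm.transpose_comp, CatTerm.transpose_comp,
    CatTerm.transpose_pair, CatTerm.transpose_comp, CatTerm.transpose_var, CatTerm.transpose_var,
    CatTerm.transpose_var, h.transpose_param_subst, ← comp_whiskerRight_assoc, inl_distr,
    ← comp_whiskerRight_assoc, inr_distr, inl_copair, inr_copair, reassoc_of% e1, reassoc_of% e2]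

theorem leftVar_iff :
    ((substTheory V).lhs .leftVar).interp B = ((substTheory V).rhs .leftVar).interp B ↔
      ∀ {X : C} (x : X ⟶ B.carrier), substAt s (fst V X ≫ w) x = x := by
  change (sub gvar (.var (𝟙 (𝟙_ C)))).interp B = (CatTerm.var (𝟙 (𝟙_ C))).interp B ↔ _
  have key : ∀ {X : C} (φ : 𝟙_ C ⊗ X ⟶ B.carrier),
      transpose ((sub gvar (.var (𝟙 (𝟙_ C)))).interp B) φ =
        snd (𝟙_ C) X ≫ substAt s (fst V X ≫ w) (unitLift X ≫ φ) := fun φ => by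
    rw [h.transpose_sub, h.transpose_gvar, CatTerm.transpose_var, id_whiskerRight,
      Category.id_comp]
  constructor
  · intro e X x
    have := key (snd (𝟙_ C) X ≫ x)
    rw [e, CatTerm.transpose_var, id_whiskerRight, Category.id_comp, lift_snd_assoc,
      Category.id_comp] at this
    simpa using unitLift X ≫= this.symm
  · intro e
    apply transpose_ext
    intro X φ
    rw [key, e, CatTerm.transpose_var, id_whiskerRight, Category.id_comp, ← Category.assoc,
      snd_unitLift, Category.id_comp]

theorem contract_iff :
    ((substTheory V).lhs .contract).interp B = ((substTheory V).rhs .contract).interp B ↔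
      ∀ {X : C} (x : V ⊗ V ⊗ X ⟶ B.carrier),
        substAt s x (fst V X ≫ w) = lift (fst V X) (𝟙 (V ⊗ X)) ≫ x := by
  change (subUnder (.var (𝟙 (V ⊗ V))) gvar).interp B =
    (CatTerm.var (lift (𝟙 V) (𝟙 V))).interp B ↔ _
  have key : ∀ {X : C} (φ : (V ⊗ V) ⊗ X ⟶ B.carrier),
      transpose ((subUnder (.var (𝟙 (V ⊗ V))) gvar).interp B) φ =
        substAt s (exch V V X ≫ (α_ V V X).inv ≫ φ) (fst V X ≫ w) := fun φ => by
    rw [h.transpose_subUnder, h.transpose_gvar, CatTerm.transpose_var, id_whiskerRight,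
      Category.id_comp]
  have key' : ∀ {X : C}, lift (𝟙 V) (𝟙 V) ▷ X =
      lift (fst V X) (𝟙 (V ⊗ X)) ≫ exch V V X ≫ (α_ V V X).inv := fun {X} => by
    ext <;> simp [exch]
  constructor
  · intro e X x
    have := key ((α_ V V X).hom ≫ exch V V X ≫ x)
    rw [e, CatTerm.transpose_var, key'] at this
    simp only [Category.assoc, Iso.inv_hom_id_assoc] at this
    rw [← Category.assoc (exch V V X), exch_exch, Category.id_comp] at this
    exact this.symm
  · intro e
    apply transpose_ext
    intro X φ
    rw [key, e, CatTerm.transpose_var, key', Category.assoc, Category.assoc]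

theorem weaken_iff :
    ((substTheory V).lhs .weaken).interp B = ((substTheory V).rhs .weaken).interp B ↔
      ∀ {X : C} (x y : X ⟶ B.carrier), substAt s (snd V X ≫ x) y = x := by
  change (sub (.var (toUnit V ≫ coprod.inl)) (.var coprod.inr)).interp B =
    (CatTerm.var (coprod.inl : 𝟙_ C ⟶ 𝟙_ C ⨿ 𝟙_ C)).interp B ↔ _
  have key : ∀ {X : C} (φ : (𝟙_ C ⨿ 𝟙_ C) ⊗ X ⟶ B.carrier),
      transpose ((sub (V := V) (.var (toUnit V ≫ coprod.inl)) (.var coprod.inr)).interp B) φ =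
        snd (𝟙_ C) X ≫ substAt s (snd V X ≫ unitLift X ≫ (coprod.inl : 𝟙_ C ⟶ _) ▷ X ≫ φ)
          (unitLift X ≫ (coprod.inr : 𝟙_ C ⟶ _) ▷ X ≫ φ) := fun {X} φ => by
    have : toUnit V ▷ X = snd V X ≫ unitLift X := by ext; simp
    rw [h.transpose_sub, CatTerm.transpose_var, CatTerm.transpose_var, comp_whiskerRight, this]
    simp only [Category.assoc]
  constructor
  · intro e X x y
    have := key (copair (snd (𝟙_ C) X ≫ x) (snd (𝟙_ C) X ≫ y))
    rw [e, CatTerm.transpose_var, inl_copair, inr_copair] at this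
    simpa using unitLift X ≫= this.symm
  · intro e
    apply transpose_ext
    intro X φ
    rw [key, e, CatTerm.transpose_var, ← Category.assoc, snd_unitLift, Category.id_comp]

theorem assoc_iff :
    ((substTheory V).lhs .assoc).interp B = ((substTheory V).rhs .assoc).interp B ↔
      ∀ {X : C} (x : V ⊗ V ⊗ X ⟶ B.carrier) (y : V ⊗ X ⟶ B.carrier) (z : X ⟶ B.carrier),
        substAt s (substAt s x y) z =
          substAt s (substAt s (exch V V X ≫ x) (snd V X ≫ z)) (substAt s y z) := by
  change (sub (subUnder (.var (coprod.inl ≫ coprod.inl)) (.var (coprod.inr ≫ coprod.inl)))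
      (.var coprod.inr)).interp B =
    (sub (subUnder (.var (lift (snd V V) (fst V V) ≫ coprod.inl ≫ coprod.inl))
      (.var (toUnit V ≫ coprod.inr)))
      (sub (.var (coprod.inr ≫ coprod.inl)) (.var coprod.inr))).interp B ↔ _
  have hswap : ∀ {X Z : C} (f : (V ⊗ V) ⊗ X ⟶ Z),
      exch V V X ≫ (α_ V V X).inv ≫ lift (snd V V) (fst V V) ▷ X ≫ f = (α_ V V X).inv ≫ f := by
    intro X Z f
    simp only [← Category.assoc]
    congr 1
    ext <;> simp [exch]
  have key1 : ∀ {X : C} (x : V ⊗ V ⊗ X ⟶ B.carrier) (y : V ⊗ X ⟶ B.carrier)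
      (z : X ⟶ B.carrier),
      transpose ((sub (subUnder (.var (coprod.inl ≫ coprod.inl)) (.var (coprod.inr ≫ coprod.inl)))
      (.var coprod.inr)).interp B)
        (copair (copair ((α_ V V X).hom ≫ exch V V X ≫ x) y) (snd (𝟙_ C) X ≫ z)) =
      snd (𝟙_ C) X ≫ substAt s (substAt s x y) z := fun {X} x y z => by
    rw [h.transpose_sub, h.transpose_subUnder, CatTerm.transpose_var, CatTerm.transpose_var,
      CatTerm.transpose_var, comp_whiskerRight_assoc, comp_whiskerRight_assoc,
      inl_copair, inl_copair, inr_copair, inr_copair, Iso.inv_hom_id_assoc, ← Category.assoc (exch V V X),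
      exch_exch, Category.id_comp, lift_snd_assoc, Category.id_comp]
  have key2 : ∀ {X : C} (x : V ⊗ V ⊗ X ⟶ B.carrier) (y : V ⊗ X ⟶ B.carrier)
      (z : X ⟶ B.carrier),
      transpose ((sub (subUnder (.var (lift (snd V V) (fst V V) ≫ coprod.inl ≫ coprod.inl))
      (.var (toUnit V ≫ coprod.inr)))
      (sub (.var (coprod.inr ≫ coprod.inl)) (.var coprod.inr))).interp B)
        (copair (copair ((α_ V V X).hom ≫ exch V V X ≫ x) y) (snd (𝟙_ C) X ≫ z)) =
      snd (𝟙_ C) X ≫ substAt s (substAt s (exch V V X ≫ x) (snd V X ≫ z)) (substAt s y z) :=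
      fun {X} x y z => by
    rw [h.transpose_sub, h.transpose_sub, h.transpose_subUnder, CatTerm.transpose_var,
      CatTerm.transpose_var, CatTerm.transpose_var, CatTerm.transpose_var,
      comp_whiskerRight_assoc, comp_whiskerRight_assoc, comp_whiskerRight_assoc,
      comp_whiskerRight_assoc,
      inl_copair, inl_copair, inr_copair, inr_copair, hswap, Iso.inv_hom_id_assoc,
      lift_snd_assoc, Category.id_comp, whiskerRight_snd_assoc, lift_snd_assoc, Category.id_comp]
  constructor
  · intro e X x y z
    have := key1 x y z
    rw [e, key2] at this
    simpa using unitLift X ≫= this.symm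
  · intro e
    apply transpose_ext
    intro X φ
    have : φ = copair (copair ((α_ V V X).hom ≫ exch V V X ≫
        (exch V V X ≫ (α_ V V X).inv ≫ coprod.inl ▷ X ≫ coprod.inl ▷ X ≫ φ))
          (coprod.inr ▷ X ≫ coprod.inl ▷ X ≫ φ))
        (snd (𝟙_ C) X ≫ unitLift X ≫ coprod.inr ▷ X ≫ φ) := by
      apply copair_ext
      · apply copair_ext
        · rw [inl_copair, inl_copair, ← Category.assoc (exch V V X), exch_exch, Category.id_comp,
            Iso.hom_inv_id_assoc]
        · rw [inl_copair, inr_copair]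
      · rw [inr_copair, ← Category.assoc, snd_unitLift, Category.id_comp]
    rw [this, key1, key2, e]

theorem isSubst_iff : IsSubst s w ↔ ∀ e : (substTheory V).Eqn,
    ((substTheory V).lhs e).interp B = ((substTheory V).rhs e).interp B := by
  constructor
  · rintro ⟨h1, h2, h3, h4⟩ (_ | _ | _ | _)
    · exact h.leftVar_iff.2 h1
    · exact h.contract_iff.2 h2
    · exact h.weaken_iff.2 h3
    · exact h.assoc_iff.2 h4
  · intro e
    exact ⟨h.leftVar_iff.1 (e .leftVar), h.contract_iff.1 (e .contract), h.weaken_iff.1 (e .weaken),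
      h.assoc_iff.1 (e .assoc)⟩

end Interprets

end Cartesian

section Cartesian

variable {C : Type u} [Category.{v} C] [CartesianMonoidalCategory C] [MonoidalClosed C]

theorem transpose_natural {P Q A B : C} (f : (P ⟹ A) ⟶ (Q ⟹ B)) {X Y : C} (h : Y ⟶ X)
    (φ : P ⊗ X ⟶ A) : Q ◁ h ≫ transpose f φ = transpose f (P ◁ h ≫ φ) := by
  rw [transpose, ← uncurry_natural_left, transpose, curry_natural_left, Category.assoc]

theorem transpose_curry {P Q A B : C} (ψ : Q ⊗ (P ⟹ A) ⟶ B) {X : C} (φ : P ⊗ X ⟶ A) :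
    transpose (curry ψ) φ = Q ◁ curry φ ≫ ψ := by
  rw [transpose, uncurry_natural_left, uncurry_curry]

open ExpMonad

variable {V : C}

theorem genVar_injective {A : C} {v v' : 𝟙_ C ⟶ (V ⟹ A)} (h : genVar v = genVar v') : v = v' := by
  have := toUnit_genVar v (𝟙_ C)
  rw [h, ← toUnit_genVar v'] at this
  rwa [toUnit_unit, Category.id_comp, Category.id_comp] at this

theorem substAt_hom_iff {A A' : C} (s : (V ⟹ A) ⊗ A ⟶ A) (s' : (V ⟹ A') ⊗ A' ⟶ A')
    (h : A ⟶ A') : s ≫ h = bulletMap V h ≫ s' ↔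
      ∀ {X : C} (f : V ⊗ X ⟶ A) (y : X ⟶ A), substAt s f y ≫ h = substAt s' (f ≫ h) (y ≫ h) := by
  have key : ∀ {X : C} (f : V ⊗ X ⟶ A) (y : X ⟶ A),
      lift (curry f) y ≫ bulletMap V h ≫ s' = substAt s' (f ≫ h) (y ≫ h) := fun f y => by
    rw [bulletMap, lift_map_assoc, ← curry_natural_right]
    rfl
  constructor
  · intro e X f y
    rw [← key, ← e, substAt, Category.assoc]
  · intro e
    apply prod_hom_ext
    intro X x y
    rw [key, ← e, substAt, Category.assoc]

theorem transpose_hom_iff {P Q A A' : C} (f : (P ⟹ A) ⟶ (Q ⟹ A)) (f' : (P ⟹ A') ⟶ (Q ⟹ A'))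
    (h : A ⟶ A') : f ≫ (ihom Q).map h = (ihom P).map h ≫ f' ↔
      ∀ {X : C} (φ : P ⊗ X ⟶ A), transpose f φ ≫ h = transpose f' (φ ≫ h) := by
  constructor
  · intro e X φ
    rw [← transpose_map Q, ← transpose_comp, e, transpose_comp, transpose_map]
  · intro e
    apply transpose_ext
    intro X φ
    rw [transpose_comp, transpose_comp, transpose_map, transpose_map, e]

theorem genVar_hom_iff {A A' : C} (w : 𝟙_ C ⟶ (V ⟹ A)) (w' : 𝟙_ C ⟶ (V ⟹ A')) (h : A ⟶ A') :
    w ≫ (ihom V).map h = w' ↔ genVar w ≫ h = genVar w' := by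
  have key : genVar (w ≫ (ihom V).map h) = genVar w ≫ h := by
    rw [genVar, uncurry_natural_right, genVar, Category.assoc]
  rw [← key]
  exact ⟨fun e => by rw [e], genVar_injective⟩

theorem SubstAlg.ext_of_eq {A : C} {s s' : (V ⟹ A) ⊗ A ⟶ A} {w w' : 𝟙_ C ⟶ (V ⟹ A)}
    (h : IsSubst s (genVar w)) (h' : IsSubst s' (genVar w')) (hs : s = s') (hw : w = w') :
    SubstAlg.ofIsSubst s w h = SubstAlg.ofIsSubst s' w' h' := by
  subst hs hw
  rfl

variable [HasBinaryCoproducts C]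

theorem whiskerLeft_copair {P Q X Y A : C} (k : Y ⟶ X) (f : P ⊗ X ⟶ A) (g : Q ⊗ X ⟶ A) :
    (P ⨿ Q) ◁ k ≫ copair f g = copair (P ◁ k ≫ f) (Q ◁ k ≫ g) := by
  apply copair_ext
  · rw [inl_copair, ← whisker_exchange_assoc, inl_copair]
  · rw [inr_copair, ← whisker_exchange_assoc, inr_copair]

theorem copair_comp {P Q X A B : C} (f : P ⊗ X ⟶ A) (g : Q ⊗ X ⟶ A) (h : A ⟶ B) :
    copair f g ≫ h = copair (f ≫ h) (g ≫ h) := by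
  apply copair_ext
  · rw [inl_copair, ← Category.assoc, inl_copair]
  · rw [inr_copair, ← Category.assoc, inr_copair]

variable [HasInitial C]

omit [HasBinaryCoproducts C] in
theorem initial_tensor_ext {X A : C} (f g : (⊥_ C) ⊗ X ⟶ A) : f = g := by
  rw [← swap_swap_assoc f, ← swap_swap_assoc g]
  congr 1
  apply curry_injective
  exact initial.hom_ext _ _

open SubstTerm

/-- The substitution given by a structure for the signature of substitution. -/
def CatStr.subst (B : CatStr (substSig V)) : (V ⟹ B.carrier) ⊗ B.carrier ⟶ B.carrier :=
  unitLift _ ≫ transpose (substTerm.interp B) (copair (uncurry (fst _ _)) (snd _ _ ≫ snd _ _))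

/-- The generic variable given by a structure for the signature of substitution. -/
def CatStr.var (B : CatStr (substSig V)) : 𝟙_ C ⟶ (V ⟹ B.carrier) :=
  curry (transpose (varTerm.interp B) (lift (snd _ _) (fst _ _) ≫ uncurry (initial.to _)))

theorem CatStr.substAt_subst (B : CatStr (substSig V)) {X : C} (f : V ⊗ X ⟶ B.carrier)
    (u : X ⟶ B.carrier) :
    substAt B.subst f u =
      unitLift X ≫ transpose (substTerm.interp B) (copair f (snd (𝟙_ C) X ≫ u)) := by
  rw [substAt, CatStr.subst, ← Category.assoc, ← whiskerLeft_unitLift, Category.assoc,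
    transpose_natural, whiskerLeft_copair, ← uncurry_natural_left, lift_fst, uncurry_curry,
    whiskerLeft_snd_assoc, lift_snd]

theorem CatStr.interprets (B : CatStr (substSig V)) : Interprets B B.subst (genVar B.var) where
  subst φ := by
    rw [substAt_subst, ← Category.assoc, snd_unitLift, Category.id_comp]
    congr 1
    apply copair_ext
    · rw [inl_copair]
    · rw [inr_copair, ← Category.assoc, snd_unitLift, Category.id_comp]
  var {X} φ := by
    rw [initial_tensor_ext φ ((⊥_ C) ◁ toUnit X ≫ lift (snd _ _) (fst _ _) ≫
      uncurry (initial.to _)), ← transpose_natural, genVar, CatStr.var, uncurry_curry,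
      ← Category.assoc (fst V X)]
    congr 1
    ext
    simp

/-- A structure for the signature of substitution, from a substitution and a generic variable. -/
def CatStr.ofSubst {A : C} (s : (V ⟹ A) ⊗ A ⟶ A) (w : 𝟙_ C ⟶ (V ⟹ A)) :
    CatStr (substSig V) where
  carrier := A
  op
    | .subst => (curry (snd (𝟙_ C) ((V ⨿ 𝟙_ C) ⟹ A) ≫
        substAt s ((coprod.inl : V ⟶ V ⨿ 𝟙_ C) ▷ _ ≫ uncurry (𝟙 ((V ⨿ 𝟙_ C) ⟹ A)))
          (unitLift _ ≫ (coprod.inr : 𝟙_ C ⟶ V ⨿ 𝟙_ C) ▷ _ ≫ uncurry (𝟙 ((V ⨿ 𝟙_ C) ⟹ A)))) :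
        ((V ⨿ 𝟙_ C) ⟹ A) ⟶ (𝟙_ C ⟹ A))
    | .var => (toUnit ((⊥_ C) ⟹ A) ≫ w : ((⊥_ C) ⟹ A) ⟶ (V ⟹ A))

theorem CatStr.ofSubst_interprets {A : C} (s : (V ⟹ A) ⊗ A ⟶ A) (w : 𝟙_ C ⟶ (V ⟹ A)) :
    Interprets (CatStr.ofSubst s w) s (genVar w) where
  subst {X} φ := by
    have key : ∀ φ : (V ⨿ 𝟙_ C) ⊗ X ⟶ A, 𝟙_ C ◁ curry φ ≫ snd (𝟙_ C) ((V ⨿ 𝟙_ C) ⟹ A) ≫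
        substAt s ((coprod.inl : V ⟶ V ⨿ 𝟙_ C) ▷ _ ≫ uncurry (𝟙 ((V ⨿ 𝟙_ C) ⟹ A)))
          (unitLift _ ≫ (coprod.inr : 𝟙_ C ⟶ V ⨿ 𝟙_ C) ▷ _ ≫ uncurry (𝟙 ((V ⨿ 𝟙_ C) ⟹ A))) =
        snd (𝟙_ C) X ≫ substAt s ((coprod.inl : V ⟶ V ⨿ 𝟙_ C) ▷ X ≫ φ)
          (unitLift X ≫ (coprod.inr : 𝟙_ C ⟶ V ⨿ 𝟙_ C) ▷ X ≫ φ) := by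
      intro φ
      rw [whiskerLeft_snd_assoc, substAt_natural, whisker_exchange_assoc, ← uncurry_natural_left,
        Category.comp_id, uncurry_curry, ← reassoc_of% (whiskerLeft_unitLift (curry φ)),
        whisker_exchange_assoc, ← uncurry_natural_left, Category.comp_id, uncurry_curry]
    exact (transpose_curry _ _).trans (key φ)
  var {X} φ := by
    exact (congrArg uncurry (Category.assoc _ _ _).symm).trans (fst_genVar_uncurry w _)

theorem Interprets.subst_eq {B : CatStr (substSig V)}
    {s s' : (V ⟹ B.carrier) ⊗ B.carrier ⟶ B.carrier} {w w' : V ⟶ B.carrier}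
    (h : Interprets B s w) (h' : Interprets B s' w') : s = s' := by
  apply prod_hom_ext
  intro X x y
  have := unitLift X ≫= ((h.subst (copair x (snd (𝟙_ C) X ≫ y))).symm.trans (h'.subst _))
  simpa [inl_copair, inr_copair, substAt] using this

theorem Interprets.var_eq {B : CatStr (substSig V)}
    {s s' : (V ⟹ B.carrier) ⊗ B.carrier ⟶ B.carrier} {w w' : V ⟶ B.carrier}
    (h : Interprets B s w) (h' : Interprets B s' w') : w = w' := by
  have := (ρ_ V).inv ≫= ((h.var (X := 𝟙_ C) (lift (snd _ _) (fst _ _) ≫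
    uncurry (initial.to _))).symm.trans (h'.var _))
  simpa using this

theorem CatStr.hom_iff {B B' : CatStr (substSig V)} (h : B.carrier ⟶ B'.carrier) :
    (∀ o : (substSig V).Op, B.op o ≫ (ihom ((substSig V).coar o)).map h =
      (ihom ((substSig V).ar o)).map h ≫ B'.op o) ↔
    B.subst ≫ h = bulletMap V h ≫ B'.subst ∧ B.var ≫ (ihom V).map h = B'.var := by
  have h1 : substTerm.interp B ≫ (ihom (𝟙_ C)).map h =
      (ihom (V ⨿ 𝟙_ C)).map h ≫ substTerm.interp B' ↔
      B.subst ≫ h = bulletMap V h ≫ B'.subst := by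
    rw [substAt_hom_iff, transpose_hom_iff]
    constructor
    · intro e X f y
      rw [substAt_subst, substAt_subst, Category.assoc, e, copair_comp, Category.assoc]
    · intro e X φ
      rw [B.interprets.subst, B'.interprets.subst, Category.assoc, e]
      simp only [Category.assoc]
  have h2 : varTerm.interp B ≫ (ihom V).map h = (ihom (⊥_ C)).map h ≫ varTerm.interp B' ↔
      B.var ≫ (ihom V).map h = B'.var := by
    rw [genVar_hom_iff, transpose_hom_iff]
    constructor
    · intro e
      have := (ρ_ V).inv ≫= e (lift (snd _ _) (fst _ _) ≫ uncurry (initial.to _))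
      rw [B.interprets.var, B'.interprets.var] at this
      simpa using this
    · intro e X φ
      rw [B.interprets.var, B'.interprets.var, Category.assoc, e]
  rw [← h1, ← h2]
  constructor
  · intro e
    exact ⟨e .subst, e .var⟩
  · rintro ⟨e1, e2⟩ (_ | _)
    · exact e1
    · exact e2

/-- The functor from algebras of the theory of substitution to substitution algebras. -/
def CatPres.Alg.toSubstAlg (V : C) : (substTheory V).Alg ⥤ SubstAlg V where
  obj B := SubstAlg.ofIsSubst _ _ ((CatStr.interprets (V := V) B.toCatStr).isSubst_iff.2 B.eqn)
  map f := ⟨f.hom, ((CatStr.hom_iff _).1 f.op_hom).2, ((CatStr.hom_iff _).1 f.op_hom).1⟩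

instance (V : C) : (CatPres.Alg.toSubstAlg V).Faithful where
  map_injective h := CatPres.Alg.Hom.ext (congrArg SubstAlg.Hom.hom h)

instance (V : C) : (CatPres.Alg.toSubstAlg V).Full where
  map_surjective f := ⟨⟨f.hom, (CatStr.hom_iff _).2 ⟨f.s_hom, f.v_hom⟩⟩, rfl⟩

instance (V : C) : (CatPres.Alg.toSubstAlg V).EssSurj where
  mem_essImage B := by
    let A : (substTheory V).Alg :=
      ⟨CatStr.ofSubst B.s B.v, (CatStr.ofSubst_interprets B.s B.v).isSubst_iff.1 B.isSubst⟩
    have hs : CatStr.subst (V := V) A.toCatStr = B.s :=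
      (CatStr.interprets (V := V) A.toCatStr).subst_eq (CatStr.ofSubst_interprets B.s B.v)
    have hv : CatStr.var (V := V) A.toCatStr = B.v :=
      genVar_injective ((CatStr.interprets (V := V) A.toCatStr).var_eq
        (CatStr.ofSubst_interprets B.s B.v))
    exact ⟨A, ⟨eqToIso (SubstAlg.ext_of_eq
      ((CatStr.interprets (V := V) A.toCatStr).isSubst_iff.2 A.eqn) B.isSubst hs hv)⟩⟩

instance (V : C) : (CatPres.Alg.toSubstAlg V).IsEquivalence where

/-- Substitution algebras are the algebras of the theory of substitution, over `C`. -/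
theorem substTheory_alg_equivalence (V : C) : ∃ M : (substTheory V).Alg ≌ SubstAlg V,
    Nonempty (M.functor ⋙ SubstAlg.forget V ≅ CatPres.Alg.forget (substTheory V)) :=
  ⟨(CatPres.Alg.toSubstAlg V).asEquivalence, ⟨Iso.refl _⟩⟩

end Cartesian

/-! ## Simultaneous substitution from substitution of a single variable -/

/-- A covariant presheaf of sets on finite cardinals, in elementary terms. -/
structure RenSet where
  obj : ℕ → Type u
  map : ∀ {m n}, (Fin m → Fin n) → obj m → obj n
  map_id : ∀ {n} (x : obj n), map (fun i => i) x = x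
  map_map : ∀ {l m n} (g : Fin m → Fin n) (f : Fin l → Fin m) (x : obj l),
    map g (map f x) = map (fun i => g (f i)) x

/-- The extension of a function by a new element, numbered `0`. -/
def upFun {m n : ℕ} (f : Fin m → Fin n) : Fin (m + 1) → Fin (n + 1) :=
  Fin.cases 0 fun i => (f i).succ

/-- The exchange of the elements `0` and `1`. -/
def swapFun {n : ℕ} : Fin (n + 2) → Fin (n + 2) :=
  Fin.cases 1 (Fin.cases 0 fun i => i.succ.succ)

/-- The function that sends `0` to `i` and `j + 1` to `j`. -/
def instFun {n : ℕ} (i : Fin n) : Fin (n + 1) → Fin n :=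
  Fin.cases i fun j => j

section

variable {m n : ℕ}

@[simp] theorem swapFun_zero : swapFun (0 : Fin (n + 2)) = 1 := rfl
@[simp] theorem swapFun_one : swapFun (1 : Fin (n + 2)) = 0 := rfl
@[simp] theorem swapFun_succ_succ (i : Fin n) : swapFun i.succ.succ = i.succ.succ := rfl
@[simp] theorem instFun_zero (i : Fin n) : instFun i 0 = i := rfl
@[simp] theorem instFun_succ (i j : Fin n) : instFun i j.succ = j := rfl

end

theorem RenSet.map_congr (B : RenSet.{u}) {m n : ℕ} {f g : Fin m → Fin n} (h : ∀ i, f i = g i)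
    (x : B.obj m) : B.map f x = B.map g x := by
  rw [funext h]

theorem forall_fin_succ {n : ℕ} {P : Fin (n + 1) → Prop} (h0 : P 0) (hs : ∀ i : Fin n, P i.succ) :
    ∀ i, P i := Fin.cases h0 hs

theorem forall_fin_succ_succ {n : ℕ} {P : Fin (n + 2) → Prop} (h0 : P 0) (h1 : P 1)
    (hs : ∀ i : Fin n, P i.succ.succ) : ∀ i, P i := Fin.cases h0 (Fin.cases h1 hs)

/-- A substitution algebra in elementary terms. -/
structure SubstSet extends RenSet.{u} where
  sub : ∀ {n}, obj (n + 1) → obj n → obj n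
  var : obj 1
  map_sub : ∀ {m n} (f : Fin m → Fin n) (t : obj (m + 1)) (x : obj m),
    map f (sub t x) = sub (map (upFun f) t) (map f x)
  left_var : ∀ {n} (x : obj n), sub (map (fun _ => 0) var) x = x
  contract : ∀ {n} (x : obj (n + 2)), sub x (map (fun _ => 0) var) = map (instFun 0) x
  weaken : ∀ {n} (x y : obj n), sub (map Fin.succ x) y = x
  assoc : ∀ {n} (x : obj (n + 2)) (y : obj (n + 1)) (z : obj n),
    sub (sub x y) z = sub (sub (map swapFun x) (map Fin.succ z)) (sub y z)

namespace SubstSet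

/-- The variable with number `i`. -/
def vari (A : SubstSet.{u}) {n : ℕ} (i : Fin n) : A.obj n := A.map (fun _ => i) A.var

theorem map_vari (A : SubstSet.{u}) {m n : ℕ} (f : Fin m → Fin n) (i : Fin m) :
    A.map f (A.vari i) = A.vari (f i) := A.map_map _ _ _

/-- A presheaf with an action of a substitution algebra `A`: terms of another sort in which terms
of `A` can be substituted. -/
structure Mod (A : SubstSet.{u}) extends RenSet.{u} where
  act : ∀ {n}, obj (n + 1) → A.obj n → obj n
  map_act : ∀ {m n} (f : Fin m → Fin n) (t : obj (m + 1)) (x : A.obj m),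
    map f (act t x) = act (map (upFun f) t) (A.map f x)
  act_vari : ∀ {n} (x : obj (n + 1)) (i : Fin n), act x (A.vari i) = map (instFun i) x
  weaken : ∀ {n} (x : obj n) (y : A.obj n), act (map Fin.succ x) y = x
  assoc : ∀ {n} (x : obj (n + 2)) (y : A.obj (n + 1)) (z : A.obj n),
    act (act x y) z = act (act (map swapFun x) (A.map Fin.succ z)) (A.sub y z)

variable {A : SubstSet.{u}}

/-- A substitution algebra acts on itself. -/
def self (A : SubstSet.{u}) : Mod A where
  toRenSet := A.toRenSet
  act := A.sub
  map_act := A.map_sub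
  act_vari {n} x i := by
    have h := congrArg (A.map (instFun i)) (A.contract (A.map (upFun Fin.succ) x))
    rw [A.map_sub, A.map_map, A.map_map, A.map_map, A.map_map] at h
    convert h using 1
    · congr 1
      rw [← A.map_id x, A.map_map]
      exact A.map_congr (by exact forall_fin_succ rfl fun _ => rfl) _
    · exact A.map_congr (by exact forall_fin_succ rfl fun _ => rfl) _
  weaken := A.weaken
  assoc := A.assoc

namespace Mod

/-- The module of terms with an additional variable, numbered `0`. -/
def shift (B : Mod A) : Mod A where
  obj n := B.obj (n + 1)
  map f := B.map (upFun f)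
  map_id x := (B.map_congr (by exact forall_fin_succ rfl fun _ => rfl) x).trans (B.map_id x)
  map_map g f x := (B.map_map _ _ x).trans
    (B.map_congr (by exact forall_fin_succ rfl fun _ => rfl) x)
  act x y := B.act (B.map swapFun x) (A.map Fin.succ y)
  map_act f t x := by
    rw [B.map_act, B.map_map, B.map_map, A.map_map, A.map_map]
    congr 1
    exact B.map_congr (by exact forall_fin_succ_succ rfl rfl fun _ => rfl) _
  act_vari x i := by
    rw [A.map_vari, B.act_vari, B.map_map]
    exact B.map_congr (by exact forall_fin_succ_succ rfl rfl fun _ => rfl) _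
  weaken x y := by
    rw [B.map_map]
    convert B.weaken x (A.map Fin.succ y) using 2
    exact B.map_congr (by exact forall_fin_succ rfl fun _ => rfl) _
  assoc {n} x y z := by
    rw [B.map_act, B.assoc, B.map_act, B.map_map, B.map_map, A.map_map, A.map_map, A.map_sub,
      B.map_map, A.map_map]
    congr 2
    rw [B.map_map]
    refine B.map_congr ?_ _
    exact Fin.cases rfl (forall_fin_succ_succ rfl rfl fun _ => rfl)

/-- A morphism of modules in two arguments. -/
structure BiHom (B B' D : Mod A) where
  app : ∀ {n}, B.obj n → B'.obj n → D.obj n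
  map_app : ∀ {m n} (f : Fin m → Fin n) (x : B.obj m) (y : B'.obj m),
    D.map f (app x y) = app (B.map f x) (B'.map f y)
  act_app : ∀ {n} (x : B.obj (n + 1)) (y : B'.obj (n + 1)) (z : A.obj n),
    D.act (app x y) z = app (B.act x z) (B'.act y z)

/-- The shift of a morphism in two arguments. -/
def BiHom.shift {B B' D : Mod A} (h : BiHom B B' D) : BiHom B.shift B'.shift D.shift where
  app x y := h.app x y
  map_app _ x y := h.map_app _ x y
  act_app x y z := by
    exact (congrArg (D.act · (A.map Fin.succ z)) (h.map_app swapFun x y)).trans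
      (h.act_app _ _ _)

/-- Weakening, with a second argument that is ignored. -/
def weakenHom (B : Mod A) : BiHom B B B.shift where
  app x _ := B.map Fin.succ x
  map_app f x _ := by
    change B.map (upFun f) _ = _
    rw [B.map_map, B.map_map]
    rfl
  act_app x _ z := by
    change B.act (B.map swapFun _) (A.map Fin.succ z) = _
    rw [B.map_map, B.map_act]
    congr 1

/-- The action of `A` is a morphism of modules. -/
def actHom (B : Mod A) : BiHom B.shift A.self B where
  app x y := B.act x y
  map_app f x y := B.map_act f x y
  act_app x y z := B.assoc x y z

/-- Simultaneous substitution. -/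
def subst : ∀ {n m : ℕ} (B : Mod A), B.obj n → (Fin n → A.obj m) → B.obj m
  | 0, _, B, t, _ => B.map Fin.elim0 t
  | n + 1, _, B, t, g => B.act (subst (n := n) B.shift t fun i => g i.succ) (g 0)

theorem BiHom.subst_app {n m : ℕ} {B B' D : Mod A} (h : BiHom B B' D) (x : B.obj n)
    (y : B'.obj n) (g : Fin n → A.obj m) :
    D.subst (h.app x y) g = h.app (B.subst x g) (B'.subst y g) := by
  induction n generalizing B B' D with
  | zero => exact h.map_app _ x y
  | succ n ih => exact (congrArg (D.act · (g 0)) (ih h.shift x y _)).trans (h.act_app _ _ _)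

theorem subst_vari {n m : ℕ} (B : Mod A) (t : B.obj n) (f : Fin n → Fin m) :
    B.subst t (fun i => A.vari (f i)) = B.map f t := by
  induction n generalizing B with
  | zero => exact B.map_congr (fun i => i.elim0) t
  | succ n ih =>
    refine (congrArg (B.act · _) (ih B.shift t fun i => f i.succ)).trans ?_
    refine (B.act_vari _ _).trans ((B.map_map _ _ _).trans ?_)
    exact B.map_congr (by exact forall_fin_succ rfl fun _ => rfl) _

theorem subst_weaken {n m : ℕ} (B : Mod A) (t : B.obj n) (g : Fin n → A.obj m) :
    B.shift.subst (n := n) (B.map Fin.succ t) g = B.map Fin.succ (B.subst t g) :=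
  B.weakenHom.subst_app t t g

theorem subst_closed {n m : ℕ} (B : Mod A) (c : B.obj 0) (g : Fin n → A.obj m) :
    B.subst (B.map Fin.elim0 c) g = B.map Fin.elim0 c := by
  induction n generalizing B with
  | zero => exact (B.map_map _ _ _).trans (B.map_congr (fun i => i.elim0) c)
  | succ n ih =>
    have h : B.map (Fin.elim0 : Fin 0 → Fin (n + 1)) c = B.map Fin.succ (B.map Fin.elim0 c) :=
      ((B.map_map _ _ _).trans (B.map_congr (fun i => i.elim0) c)).symm
    rw [h]
    refine (congrArg (B.act · _) (B.subst_weaken (B.map Fin.elim0 c) _)).trans ?_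
    rw [B.weaken, ih]

theorem self_subst_vari {n m : ℕ} (i : Fin n) (g : Fin n → A.obj m) :
    A.self.subst (A.vari i) g = g i := by
  induction n with
  | zero => exact i.elim0
  | succ n ih =>
    induction i using Fin.cases with
    | zero =>
      have h : A.vari (0 : Fin (n + 1)) = A.self.shift.map Fin.elim0 A.var :=
        A.map_congr (by exact Fin.cases rfl fun i => i.elim0) _
      refine (congrArg (fun t : A.self.shift.obj n => A.sub (A.self.shift.subst t _) _) h).trans ?_
      refine (congrArg (A.sub · (g 0)) (A.self.shift.subst_closed A.var _)).trans ?_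
      refine Eq.trans ?_ (A.left_var (g 0))
      exact congrArg (A.sub · (g 0)) (A.map_congr (by exact Fin.cases rfl fun i => i.elim0) _)
    | succ i =>
      rw [← A.map_vari Fin.succ i]
      refine (congrArg (A.sub · _) (A.self.subst_weaken (A.vari i) _)).trans ?_
      exact (A.weaken _ _).trans (ih i _)

theorem subst_subst {n m l : ℕ} (B : Mod A) (t : B.obj n) (f : Fin n → A.obj m)
    (g : Fin m → A.obj l) :
    B.subst (B.subst t f) g = B.subst t fun i => A.self.subst (f i) g := by
  induction n generalizing B with
  | zero => exact B.subst_closed t g |>.trans rfl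
  | succ n ih =>
    refine (B.actHom.subst_app _ _ g).trans ?_
    exact congrArg (B.act · _) (ih B.shift t _)

end Mod

end SubstSet

/-! ## The Lawvere theory of an elementary substitution algebra -/

namespace SubstSet

/-- The category of tuples of terms, with simultaneous substitution as composition. -/
def preLawvere (A : SubstSet.{u}) : PreLawvereTheory.{u} where
  Hom m n := Fin n → A.obj m
  id _ := fun i => A.vari i
  comp f g := fun i => A.self.subst (g i) f
  id_comp f := funext fun i => (A.self.subst_vari (f i) fun i => i).trans (A.map_id _)
  comp_id f := funext fun i => Mod.self_subst_vari i f
  assoc f g h := funext fun i => (A.self.subst_subst (h i) g f).symm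
  map f := fun i => A.vari (f i)
  map_id _ := rfl
  map_comp f g := funext fun i => (Mod.self_subst_vari (g i) fun i => A.vari (f i)).symm

theorem preLawvere_preserves (A : SubstSet.{u}) :
    PreservesFiniteProducts A.preLawvere.functor where
  preserves k := ⟨fun {K} => ⟨fun {c} hc => by
    let J := Discrete (Fin k)
    let S := Σ j : Fin k, Fin (K.obj ⟨j⟩).unop.len
    let e : S ≃ Fin (Fintype.card S) := Fintype.equivFin S
    let p : ∀ j, Fin (K.obj j).unop.len → Fin c.pt.unop.len := fun j => (c.π.app j).unop
    have hext : ∀ {M : ℕ} (f g : Fin c.pt.unop.len → Fin M),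
        (∀ j a, f (p j a) = g (p j a)) → f = g := fun {M} f g h =>
      congrArg Quiver.Hom.unop (hc.hom_ext (f := (Quiver.Hom.op (V := FinCard) (Y := ⟨M⟩) f))
        (f' := (Quiver.Hom.op (V := FinCard) (Y := ⟨M⟩) g))
        fun j => congrArg Quiver.Hom.op (funext fun a => h j a))
    let t : Cone K :=
      { pt := Opposite.op ⟨Fintype.card S⟩
        π := Discrete.natTrans fun j => Quiver.Hom.op (V := FinCard)
          (X := (K.obj j).unop) (Y := ⟨Fintype.card S⟩) fun a => e ⟨j.as, a⟩ }
    let r : Fin c.pt.unop.len → Fin (Fintype.card S) := (hc.lift t).unop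
    have hr : ∀ j a, r (p j a) = e ⟨j.as, a⟩ := fun j a =>
      congrFun (congrArg Quiver.Hom.unop (hc.fac t j)) a
    have hp : ∀ x, p ⟨(e.symm (r x)).1⟩ (e.symm (r x)).2 = x := by
      refine congrFun (hext (fun x => p ⟨(e.symm (r x)).1⟩ (e.symm (r x)).2) (fun x => x) ?_)
      intro j a
      exact congrArg (fun σ : S => p ⟨σ.1⟩ σ.2)
        ((congrArg e.symm (hr j a)).trans (e.symm_apply_apply _))
    exact ⟨
      { lift := fun s => fun x => (s.π.app ⟨(e.symm (r x)).1⟩ : Fin _ → A.obj _) (e.symm (r x)).2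
        fac := fun s j => by
          refine funext fun a => ?_
          refine (Mod.self_subst_vari (p j a) _).trans ?_
          exact congrArg (β := A.obj s.pt.len) (fun σ : S =>
              (s.π.app ⟨σ.1⟩ : Fin (K.obj ⟨σ.1⟩).unop.len → A.obj s.pt.len) σ.2)
            ((congrArg e.symm (hr j a)).trans (e.symm_apply_apply _))
        uniq := fun s m h => by
          refine funext fun x => ?_
          have := congrFun (h ⟨(e.symm (r x)).1⟩) (e.symm (r x)).2
          refine Eq.trans ?_ this
          refine Eq.trans ?_ (Mod.self_subst_vari _ _).symm
          exact congrArg m (hp x).symm }⟩⟩⟩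

/-- The Lawvere theory of an elementary substitution algebra. -/
def lawvere (A : SubstSet.{u}) : LawvereTheory.{u} where
  toPreLawvereTheory := A.preLawvere
  preserves := A.preLawvere_preserves

end SubstSet

/-! ## The elementary substitution algebra of a Lawvere theory -/

namespace LawvereTheory

variable (T : LawvereTheory.{u})

/-- The projections `n ⟶ 1` of a Lawvere theory. -/
def proj {n : ℕ} (i : Fin n) : T.Hom n 1 := T.map fun _ : Fin 1 => i

theorem exists_isLimit (n : ℕ) : Nonempty (IsLimit (Fan.mk
    (T.toPreLawvereTheory.functor.obj (Opposite.op ⟨n⟩))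
    (fun i : Fin n => T.toPreLawvereTheory.functor.map
      (Y := Opposite.op (FinCard.mk 1)) (Quiver.Hom.op (V := FinCard) fun _ : Fin 1 => i)))) := by
  have := T.preserves
  refine ⟨isLimitFanMkObjOfIsLimit _ (fun _ : Fin n => Opposite.op (FinCard.mk 1))
    (P := Opposite.op (FinCard.mk n)) (fun i => Quiver.Hom.op (V := FinCard) fun _ : Fin 1 => i) ?_⟩
  exact Fan.IsLimit.mk _
    (fun s => Quiver.Hom.op (V := FinCard) fun i : Fin n => (s.proj i).unop (0 : Fin 1))
    (fun s i => Quiver.Hom.unop_inj (funext fun a => by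
      rw [Subsingleton.elim a 0]
      rfl))
    (fun s m h => Quiver.Hom.unop_inj (funext fun i => congrFun (congrArg Quiver.Hom.unop (h i)) 0))

theorem exists_tuple {m n : ℕ} (g : Fin n → T.Hom m 1) :
    ∃ f : T.Hom m n, ∀ i, T.comp f (T.proj i) = g i := by
  obtain ⟨h⟩ := T.exists_isLimit n
  exact ⟨h.lift (Fan.mk (PreLawvereTheory.Obj.mk m) g), fun i => h.fac _ ⟨i⟩⟩

variable {T}

theorem hom_ext {m n : ℕ} {f g : T.Hom m n}
    (h : ∀ i, T.comp f (T.proj i) = T.comp g (T.proj i)) : f = g := by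
  obtain ⟨hl⟩ := T.exists_isLimit n
  exact hl.hom_ext (f := (f : (PreLawvereTheory.Obj.mk m : T.toPreLawvereTheory.Obj) ⟶ ⟨n⟩))
    (f' := g) fun ⟨i⟩ => h i

variable (T)

/-- The tupling of operations. -/
def tuple {m n : ℕ} (g : Fin n → T.Hom m 1) : T.Hom m n := (T.exists_tuple g).choose

@[simp]
theorem tuple_proj {m n : ℕ} (g : Fin n → T.Hom m 1) (i : Fin n) :
    T.comp (T.tuple g) (T.proj i) = g i := (T.exists_tuple g).choose_spec i

variable {T}

@[simp]
theorem map_proj {m n : ℕ} (f : Fin n → Fin m) (i : Fin n) :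
    T.comp (T.map f) (T.proj i) = T.proj (f i) := (T.map_comp f fun _ : Fin 1 => i).symm

@[simp]
theorem comp_tuple {l m n : ℕ} (f : T.Hom l m) (g : Fin n → T.Hom m 1) :
    T.comp f (T.tuple g) = T.tuple fun i => T.comp f (g i) :=
  hom_ext fun i => by rw [T.assoc, tuple_proj, tuple_proj]

@[simp]
theorem tuple_map {m n k : ℕ} (g : Fin n → T.Hom m 1) (f : Fin k → Fin n) :
    T.comp (T.tuple g) (T.map f) = T.tuple fun i => g (f i) :=
  hom_ext fun i => by rw [T.assoc, map_proj, tuple_proj, tuple_proj]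

theorem map_eq_tuple {m n : ℕ} (f : Fin n → Fin m) : T.map f = T.tuple fun i => T.proj (f i) :=
  hom_ext fun i => by rw [map_proj, tuple_proj]

theorem tuple_proj_id (n : ℕ) : T.tuple (fun i : Fin n => T.proj i) = T.id n := by
  rw [← map_eq_tuple, T.map_id]

theorem proj_zero : T.proj (0 : Fin 1) = T.id 1 := by
  rw [← T.map_id, proj]
  congr 1
  exact funext fun i => Subsingleton.elim _ _

/-- The morphism `n ⟶ n + 1` that instantiates the variable `0` by `u`. -/
def inst {n : ℕ} (u : T.Hom n 1) : T.Hom n (n + 1) := T.tuple (Fin.cases u fun i => T.proj i)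

theorem tuple_cases {m n : ℕ} (x : T.Hom m 1) (g : Fin n → T.Hom m 1) (h : Fin (n + 1) → T.Hom m 1)
    (h0 : h 0 = x) (hs : ∀ i : Fin n, h i.succ = g i) : T.tuple h = T.tuple (Fin.cases x g) := by
  congr 1
  exact funext (Fin.cases h0 hs)

theorem inst_map {n k : ℕ} (u : T.Hom n 1) (f : Fin k → Fin (n + 1)) :
    T.comp (inst u) (T.map f) =
      T.tuple fun i => (Fin.cases u fun i => T.proj i : Fin (n + 1) → T.Hom n 1) (f i) :=
  tuple_map _ _

theorem comp_inst {m n : ℕ} (g : T.Hom m n) (u : T.Hom n 1) :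
    T.comp g (inst u) = T.tuple (Fin.cases (T.comp g u) fun i => T.comp g (T.proj i)) := by
  rw [inst, comp_tuple]
  exact tuple_cases _ _ _ rfl fun _ => rfl

variable (T)

/-- The substitution algebra of a Lawvere theory, in elementary terms. -/
def substSet : SubstSet.{u} where
  obj n := T.Hom n 1
  map f t := T.comp (T.map f) t
  map_id x := by rw [T.map_id, T.id_comp]
  map_map g f x := by rw [T.map_comp g f, T.assoc]
  sub t x := T.comp (inst x) t
  var := T.id 1
  map_sub f t x := by
    rw [← T.assoc, ← T.assoc, comp_inst, inst_map]
    congr 2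
    funext i
    refine Fin.cases rfl (fun i => ?_) i
    exact map_proj f i
  left_var x := by
    rw [← T.assoc, T.comp_id, inst, ← proj, tuple_proj]
    rfl
  contract x := by
    rw [T.comp_id, inst, map_eq_tuple (instFun 0)]
    congr 2
    funext i
    exact Fin.cases rfl (fun i => rfl) i
  weaken x y := by
    rw [← T.assoc, inst_map]
    exact (congrArg (T.comp · x) (tuple_proj_id _)).trans (T.id_comp x)
  assoc x y z := by
    rw [← T.assoc, ← T.assoc, ← T.assoc, comp_inst, comp_inst, tuple_map]
    congr 2
    funext i
    revert i
    refine forall_fin_succ_succ ?_ ?_ ?_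
    · change _ = T.comp (inst (T.comp (inst z) y)) (T.proj 0)
      rw [inst.eq_def (T.comp (inst z) y), tuple_proj]
      rfl
    · change T.comp (inst z) (T.proj 0) = T.comp _ (T.comp (T.map Fin.succ) z)
      rw [← T.assoc, inst_map]
      exact (tuple_proj T _ _).trans ((congrArg (T.comp · z) (tuple_proj_id _)).trans
        (T.id_comp z)).symm
    · intro i
      change T.comp (inst z) (T.proj i.succ) = T.comp (inst (T.comp (inst z) y)) (T.proj i.succ)
      rw [inst, inst, tuple_proj, tuple_proj]
      rfl

end LawvereTheory

/-! ## Pointwise description of substitution algebras in the object-classifier topos -/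

namespace FinCard

open ExpMonad

/-- The components of a morphism of presheaves, as functions. -/
def ap {X Y : FinCard ⥤ Type u} (f : X ⟶ Y) {n : ℕ} (x : X.obj ⟨n⟩) : Y.obj ⟨n⟩ :=
  f.app ⟨n⟩ x

/-- The action of a function between finite cardinals on a presheaf. -/
def ren (X : FinCard ⥤ Type u) {m n : ℕ} (k : Fin m → Fin n) (x : X.obj ⟨m⟩) : X.obj ⟨n⟩ :=
  X.map (X := ⟨m⟩) (Y := ⟨n⟩) k x

/-- Pairs of elements of presheaves. -/
def pr {X Y : FinCard ⥤ Type u} {n : ℕ} (x : X.obj ⟨n⟩) (y : Y.obj ⟨n⟩) : (X ⊗ Y).obj ⟨n⟩ :=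
  (x, y)

/-- The elements of the universal object. -/
def vr {n : ℕ} (a : Fin n) : universalObject.{u}.obj ⟨n⟩ := ⟨fun _ => a⟩

section

variable {X Y Z W : FinCard ⥤ Type u} {l m n : ℕ}

theorem ext_ap {f g : X ⟶ Y} (h : ∀ (n : ℕ) (x : X.obj ⟨n⟩), ap f x = ap g x) : f = g := by
  ext n x
  exact h n.len x

@[simp] theorem ap_comp (f : X ⟶ Y) (g : Y ⟶ Z) (x : X.obj ⟨n⟩) : ap (f ≫ g) x = ap g (ap f x) := rfl
@[simp] theorem ap_id (x : X.obj ⟨n⟩) : ap (𝟙 X) x = x := rfl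
@[simp] theorem ap_fst (x : X.obj ⟨n⟩) (y : Y.obj ⟨n⟩) : ap (fst X Y) (pr x y) = x := rfl
@[simp] theorem ap_snd (x : X.obj ⟨n⟩) (y : Y.obj ⟨n⟩) : ap (snd X Y) (pr x y) = y := rfl
@[simp] theorem ap_whiskerLeft (f : X ⟶ Y) (z : Z.obj ⟨n⟩) (x : X.obj ⟨n⟩) :
    ap (Z ◁ f) (pr z x) = pr z (ap f x) := rfl

theorem pr_surj (x : (X ⊗ Y).obj ⟨n⟩) : x = pr (ap (fst X Y) x) (ap (snd X Y) x) := rfl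

@[simp] theorem ap_lift (f : X ⟶ Y) (g : X ⟶ Z) (x : X.obj ⟨n⟩) :
    ap (lift f g) x = pr (ap f x) (ap g x) := by
  rw [pr_surj (ap (lift f g) x), ← ap_comp, ← ap_comp, lift_fst, lift_snd]

@[simp] theorem ap_exch (x : X.obj ⟨n⟩) (y : Y.obj ⟨n⟩) (z : Z.obj ⟨n⟩) :
    ap (exch X Y Z) (pr x (pr y z)) = pr y (pr x z) := by
  rw [exch, ap_lift]
  rfl

theorem ren_id (x : X.obj ⟨n⟩) : ren X (fun i => i) x = x :=
  congrArg (fun f => (f : X.obj ⟨n⟩ ⟶ X.obj ⟨n⟩) x) (X.map_id ⟨n⟩)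

theorem ren_ren (g : Fin m → Fin n) (f : Fin l → Fin m) (x : X.obj ⟨l⟩) :
    ren X g (ren X f x) = ren X (fun i => g (f i)) x :=
  (congrArg (fun f => (f : X.obj ⟨l⟩ ⟶ X.obj ⟨n⟩) x)
    (X.map_comp (X := ⟨l⟩) (Y := ⟨m⟩) (Z := ⟨n⟩) f g)).symm

theorem ap_ren (f : X ⟶ Y) (k : Fin m → Fin n) (x : X.obj ⟨m⟩) :
    ap f (ren X k x) = ren Y k (ap f x) :=
  congrArg (fun f => (f : X.obj ⟨m⟩ ⟶ Y.obj ⟨n⟩) x) (f.naturality (X := ⟨m⟩) (Y := ⟨n⟩) k)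

@[simp] theorem ren_pr (k : Fin m → Fin n) (x : X.obj ⟨m⟩) (y : Y.obj ⟨m⟩) :
    ren (X ⊗ Y) k (pr x y) = pr (ren X k x) (ren Y k y) := rfl

@[simp] theorem ren_vr (k : Fin m → Fin n) (a : Fin m) :
    ren universalObject.{u} k (vr a) = vr (k a) := rfl

theorem vr_surj (a : universalObject.{u}.obj ⟨n⟩) : a = vr (a.down (0 : Fin 1)) := by
  refine congrArg ULift.up (funext fun i => ?_)
  rw [Subsingleton.elim i (0 : Fin 1)]

end

/-- The presheaf underlying a functor, in elementary terms. -/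
def toRenSet (X : FinCard ⥤ Type u) : RenSet.{u} where
  obj n := X.obj ⟨n⟩
  map := ren X
  map_id := ren_id
  map_map := ren_ren

/-- The representable presheaf of `n`. -/
abbrev rep (n : ℕ) : FinCard ⥤ Type u := uliftCoyoneda.{u}.obj (Opposite.op (FinCard.mk n))

/-- An element of the representable presheaf. -/
def rv {n k : ℕ} (g : Fin n → Fin k) : (rep.{u} n).obj ⟨k⟩ := ⟨g⟩

/-- The function given by an element of the representable presheaf. -/
def rvInv {n k : ℕ} (g : (rep.{u} n).obj ⟨k⟩) : Fin n → Fin k := g.down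

/-- The number given by an element of the universal object. -/
def vrInv {k : ℕ} (a : universalObject.{u}.obj ⟨k⟩) : Fin k :=
  (a.down : Fin 1 → Fin k) 0

section

variable {X Y A : FinCard ⥤ Type u}

/-- A morphism of presheaves from a natural family of functions. -/
def mkHom (f : ∀ n, X.obj ⟨n⟩ → Y.obj ⟨n⟩)
    (h : ∀ {m n} (k : Fin m → Fin n) (x : X.obj ⟨m⟩), f n (ren X k x) = ren Y k (f m x)) :
    X ⟶ Y where
  app n := TypeCat.ofHom (f n.len)
  naturality m n k := by
    ext x
    exact h (m := m.len) (n := n.len) k x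

theorem rvInv_ren {n k l : ℕ} (f : Fin k → Fin l) (g : (rep.{u} n).obj ⟨k⟩) :
    rvInv (ren (rep n) f g) = fun i => f (rvInv g i) := rfl

@[simp] theorem ren_rv {n k l : ℕ} (f : Fin k → Fin l) (g : Fin n → Fin k) :
    ren (rep.{u} n) f (rv g) = rv fun i => f (g i) := rfl

theorem vrInv_ren {k l : ℕ} (f : Fin k → Fin l) (a : universalObject.{u}.obj ⟨k⟩) :
    vrInv (ren universalObject f a) = f (vrInv a) := rfl

/-- A function extended by a value at `0`. -/
def consFun {n k : ℕ} (a : Fin k) (g : Fin n → Fin k) : Fin (n + 1) → Fin k := Fin.cases a g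

theorem comp_consFun {n k l : ℕ} (f : Fin k → Fin l) (a : Fin k) (g : Fin n → Fin k) :
    (fun i => f (consFun a g i)) = consFun (f a) fun i => f (g i) :=
  funext (by exact forall_fin_succ rfl fun _ => rfl)

/-- The morphism from a representable presheaf given by an element. -/
def elt {n : ℕ} (x : A.obj ⟨n⟩) : rep.{u} n ⟶ A :=
  mkHom (fun _ g => ren A (rvInv g) x) fun k g => (ren_ren k (rvInv g) x).symm

/-- The morphism `V × y(n) ⟶ A` given by an element with an additional variable. -/
def elt₁ {n : ℕ} (x : A.obj ⟨n + 1⟩) : universalObject.{u} ⊗ rep.{u} n ⟶ A :=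
  mkHom (fun _ p => ren A (consFun (vrInv (ap (fst universalObject (rep n)) p))
      (rvInv (ap (snd universalObject (rep n)) p))) x) fun k p => by
    rw [ren_ren, ap_ren, ap_ren, vrInv_ren, rvInv_ren, comp_consFun]

/-- The morphism `V × V × y(n) ⟶ A` given by an element with two additional variables. -/
def elt₂ {n : ℕ} (x : A.obj ⟨n + 2⟩) :
    universalObject.{u} ⊗ universalObject.{u} ⊗ rep.{u} n ⟶ A :=
  mkHom (fun _ p => ren A (consFun (vrInv (ap (fst universalObject (universalObject ⊗ rep n)) p))
      (consFun (vrInv (ap (snd universalObject _ ≫ fst universalObject (rep n)) p))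
        (rvInv (ap (snd universalObject _ ≫ snd universalObject (rep n)) p)))) x) fun k p => by
    rw [ren_ren, ap_ren, ap_ren, ap_ren, vrInv_ren, rvInv_ren, vrInv_ren, comp_consFun,
      comp_consFun]

@[simp] theorem ap_elt {n k : ℕ} (x : A.obj ⟨n⟩) (g : Fin n → Fin k) :
    ap (elt x) (rv g) = ren A g x := rfl

@[simp] theorem ap_elt₁ {n k : ℕ} (x : A.obj ⟨n + 1⟩) (a : Fin k) (g : Fin n → Fin k) :
    ap (elt₁ x) (pr (vr a) (rv g)) = ren A (consFun a g) x := rfl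

@[simp] theorem ap_elt₂ {n k : ℕ} (x : A.obj ⟨n + 2⟩) (b a : Fin k) (g : Fin n → Fin k) :
    ap (elt₂ x) (pr (vr b) (pr (vr a) (rv g))) = ren A (consFun b (consFun a g)) x := rfl

/-- A substitution `s` is given at elements by the operations `σ`. -/
def Represents (s : (universalObject.{u} ⟹ A) ⊗ A ⟶ A)
    (σ : ∀ n : ℕ, A.obj ⟨n + 1⟩ → A.obj ⟨n⟩ → A.obj ⟨n⟩) : Prop :=
  ∀ (X : FinCard ⥤ Type u) (f : universalObject ⊗ X ⟶ A) (y : X ⟶ A) {n : ℕ} (ξ : X.obj ⟨n⟩),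
    ap (substAt s f y) ξ = σ n (ap f (pr (vr 0) (ren X Fin.succ ξ))) (ap y ξ)

/-- The operations that represent a substitution. -/
def subOf (s : (universalObject.{u} ⟹ A) ⊗ A ⟶ A) (n : ℕ) (t : A.obj ⟨n + 1⟩) (x : A.obj ⟨n⟩) :
    A.obj ⟨n⟩ :=
  ap (substAt s (elt₁ t) (elt x)) (rv fun i => i)

theorem represents_subOf (s : (universalObject.{u} ⟹ A) ⊗ A ⟶ A) : Represents s (subOf s) := by
  intro X f y n ξ
  have h : ap (elt ξ) (rv fun i => i) = ξ := ren_id ξ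
  conv_lhs => rw [← h]
  rw [← ap_comp, substAt_natural]
  change _ = ap (substAt s (elt₁ _) (elt _)) (rv fun i => i)
  congr 2
  · apply ext_ap
    intro k p
    rw [pr_surj p, vr_surj (ap (fst _ _) p)]
    change ap f (pr _ (ren X (rvInv (ap (snd _ _) p)) ξ)) =
      ren A (consFun _ (rvInv (ap (snd _ _) p))) _
    rw [← ap_ren, ren_pr, ren_ren, ren_vr]
    rfl
  · apply ext_ap
    intro k p
    exact ap_ren _ _ _

/-- The substitution represented by natural operations. -/
def ofSub (σ : ∀ n : ℕ, A.obj ⟨n + 1⟩ → A.obj ⟨n⟩ → A.obj ⟨n⟩)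
    (h : ∀ {m n : ℕ} (k : Fin m → Fin n) (t : A.obj ⟨m + 1⟩) (x : A.obj ⟨m⟩),
      ren A k (σ m t x) = σ n (ren A (upFun k) t) (ren A k x)) :
    (universalObject.{u} ⟹ A) ⊗ A ⟶ A :=
  mkHom (fun n p => σ n (ap (uncurry (fst (universalObject ⟹ A) A))
    (pr (vr 0) (ren _ Fin.succ p))) (ap (snd (universalObject ⟹ A) A) p)) fun k p => by
      rw [h, ap_ren (snd _ _), ← ap_ren (uncurry _), ren_pr, ren_ren, ren_ren, ren_vr]
      rfl

theorem represents_ofSub (σ : ∀ n : ℕ, A.obj ⟨n + 1⟩ → A.obj ⟨n⟩ → A.obj ⟨n⟩)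
    (h : ∀ {m n : ℕ} (k : Fin m → Fin n) (t : A.obj ⟨m + 1⟩) (x : A.obj ⟨m⟩),
      ren A k (σ m t x) = σ n (ren A (upFun k) t) (ren A k x)) : Represents (ofSub σ h) σ := by
  intro X f y n ξ
  change σ n (ap _ (pr (vr 0) (ren _ Fin.succ (ap (lift (curry f) y) ξ))))
    (ap (snd (universalObject ⟹ A) A) (ap (lift (curry f) y) ξ)) = _
  rw [← ap_comp, lift_snd, ← ap_ren, ← ap_whiskerLeft, ← ap_comp, ← uncurry_natural_left,
    lift_fst, uncurry_curry]

/-- The axioms of substitution algebras in terms of elements. -/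
structure SubAx (A : FinCard ⥤ Type u) (σ : ∀ n : ℕ, A.obj ⟨n + 1⟩ → A.obj ⟨n⟩ → A.obj ⟨n⟩)
    (var : A.obj ⟨1⟩) : Prop where
  ren_sub : ∀ {m n : ℕ} (k : Fin m → Fin n) (t : A.obj ⟨m + 1⟩) (x : A.obj ⟨m⟩),
    ren A k (σ m t x) = σ n (ren A (upFun k) t) (ren A k x)
  left_var : ∀ {n : ℕ} (x : A.obj ⟨n⟩), σ n (ren A (fun _ => 0) var) x = x
  contract : ∀ {n : ℕ} (x : A.obj ⟨n + 2⟩),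
    σ (n + 1) x (ren A (n := n + 1) (fun _ => 0) var) = ren A (instFun 0) x
  weaken : ∀ {n : ℕ} (x y : A.obj ⟨n⟩), σ n (ren A Fin.succ x) y = x
  assoc : ∀ {n : ℕ} (x : A.obj ⟨n + 2⟩) (y : A.obj ⟨n + 1⟩) (z : A.obj ⟨n⟩),
    σ n (σ (n + 1) x y) z = σ n (σ (n + 1) (ren A swapFun x) (ren A Fin.succ z)) (σ n y z)

variable {σ : ∀ n : ℕ, A.obj ⟨n + 1⟩ → A.obj ⟨n⟩ → A.obj ⟨n⟩}

/-- The elementary substitution algebra given by operations on a presheaf. -/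
def SubAx.substSet {var : A.obj ⟨1⟩} (h : SubAx A σ var) : SubstSet.{u} where
  toRenSet := toRenSet A
  sub := σ _
  var := var
  map_sub := h.ren_sub
  left_var := h.left_var
  contract := h.contract
  weaken := h.weaken
  assoc := h.assoc

theorem ap_vr (w : universalObject.{u} ⟶ A) {n : ℕ} (a : Fin n) :
    ap w (vr a) = ren A (fun _ => a) (ap w (vr (0 : Fin 1))) := by
  rw [← ap_ren, ren_vr]

theorem SubAx.isSubst {s : (universalObject.{u} ⟹ A) ⊗ A ⟶ A} (hs : Represents s σ)
    {w : universalObject.{u} ⟶ A} (h : SubAx A σ (ap w (vr (0 : Fin 1)))) : IsSubst s w where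
  left_var x := by
    apply ext_ap
    intro n ξ
    rw [hs, ap_comp, ap_fst, ap_vr, h.left_var]
  contract {X} x := by
    apply ext_ap
    intro n p
    have key : ∀ (a : Fin n) (ξ : X.obj ⟨n⟩),
        ap (substAt s x (fst universalObject X ≫ w)) (pr (vr a) ξ) =
          ap (lift (fst universalObject X) (𝟙 (universalObject ⊗ X)) ≫ x) (pr (vr a) ξ) := by
      intro a ξ
      rw [hs, ap_comp, ap_fst, ap_vr]
      refine (h.substSet.self.act_vari _ a).trans ((ap_ren x (instFun a) _).symm.trans ?_)
      simp only [ren_pr, ren_vr, ren_ren, instFun_succ, instFun_zero, ren_id, ap_comp, ap_lift,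
        ap_fst, ap_id]
    have h' := key (vrInv (ap (fst _ _) p)) (ap (snd _ _) p)
    rwa [vrInv, ← vr_surj, ← pr_surj] at h'
  weaken x y := by
    apply ext_ap
    intro n ξ
    rw [hs, ap_comp, ap_snd, ap_ren, h.weaken]
  assoc x y z := by
    apply ext_ap
    intro n ξ
    rw [hs, hs, hs, hs, hs, h.assoc, ap_comp, ap_comp, ap_snd, ← ap_ren, ← ap_ren]
    simp only [ren_pr, ren_vr, ren_ren, ap_exch, swapFun_zero, swapFun_succ_succ,
      Fin.succ_zero_eq_one, swapFun_one]

theorem ap_elt_id {n : ℕ} (x : A.obj ⟨n⟩) : ap (elt x) (rv fun i => i) = x := ren_id x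

theorem ren_eq_self {n : ℕ} {f : Fin n → Fin n} (h : ∀ i, f i = i) (x : A.obj ⟨n⟩) :
    ren A f x = x := by
  rw [funext h]
  exact ren_id x

theorem IsSubst.subAx {s : (universalObject.{u} ⟹ A) ⊗ A ⟶ A} {w : universalObject.{u} ⟶ A}
    (h : IsSubst s w) : SubAx A (subOf s) (ap w (vr (0 : Fin 1))) where
  ren_sub k t x := by
    rw [subOf, ← ap_ren, represents_subOf, ren_rv, ren_rv, ap_elt₁, ap_elt]
    rfl
  left_var x := by
    have h' := congrArg (ap · (rv fun i => i)) (h.left_var (elt x))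
    simp only [represents_subOf s _ _ _ _, ap_comp, ap_fst, ap_elt_id] at h'
    rwa [ap_vr] at h'
  contract {n} x := by
    have h' := congrArg (ap · (pr (vr 0) (rv Fin.succ))) (h.contract (elt₂ x))
    simp only [represents_subOf s _ _ _ _, ap_comp, ap_fst, ap_lift, ap_id, ren_pr, ren_vr, ren_rv,
      ap_elt₂] at h'
    rw [ap_vr, ren_eq_self (by exact forall_fin_succ_succ rfl rfl fun _ => rfl)] at h'
    refine h'.trans ?_
    congr 1
    exact funext (by exact forall_fin_succ_succ rfl rfl fun _ => rfl)
  weaken x y := by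
    have h' := congrArg (ap · (rv fun i => i)) (h.weaken (elt x) (elt y))
    simp only [represents_subOf s _ _ _ _, ap_comp, ap_snd, ap_elt_id, ap_ren] at h'
    exact h'
  assoc x y z := by
    have h' := congrArg (ap · (rv fun i => i)) (h.assoc (elt₂ x) (elt₁ y) (elt z))
    simp only [represents_subOf s _ _ _ _, ap_comp, ap_snd, ren_pr, ren_vr, ren_rv, ap_elt₂, ap_elt₁,
      ap_exch, ap_elt] at h'
    rw [ren_eq_self (by exact forall_fin_succ_succ rfl rfl fun _ => rfl),
      ren_eq_self (by exact forall_fin_succ rfl fun _ => rfl), ren_id z] at h'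
    refine h'.trans ?_
    congr 2

end

end FinCard

/-! ## Morphisms of Lawvere theories and of substitution algebras -/

namespace LawvereTheory

section

variable {T T' : LawvereTheory.{u}} (h : ∀ n, T.Hom n 1 → T'.Hom n 1)

/-- The extension of a map of operations to tuples of operations. -/
def extend {m n : ℕ} (f : T.Hom m n) : T'.Hom m n :=
  T'.tuple fun i => h m (T.comp f (T.proj i))

theorem extend_one {m : ℕ} (f : T.Hom m 1) : extend h f = h m f := by
  apply hom_ext
  intro i
  rw [extend, tuple_proj, Subsingleton.elim i 0, proj_zero, proj_zero, T.comp_id, T'.comp_id]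

theorem inst_succ {n : ℕ} (x : T.Hom n 1) : T.comp (inst x) (T.map Fin.succ) = T.id n := by
  rw [inst_map]
  exact tuple_proj_id n

theorem inst_proj_zero {n : ℕ} (x : T.Hom n 1) : T.comp (inst x) (T.proj 0) = x := by
  rw [inst, tuple_proj]
  rfl

theorem inst_proj_succ {n : ℕ} (x : T.Hom n 1) (i : Fin n) :
    T.comp (inst x) (T.proj i.succ) = T.proj i := by
  rw [inst, tuple_proj]
  rfl

/-- Substitution along `a` commutes with a map of operations. -/
def Respects {m n : ℕ} (a : T.Hom m n) : Prop :=
  ∀ t : T.Hom n 1, h m (T.comp a t) = T'.comp (extend h a) (h n t)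

variable {h}

theorem Respects.extend_comp {l m n : ℕ} {a : T.Hom l m} (ha : Respects h a) (b : T.Hom m n) :
    extend h (T.comp a b) = T'.comp (extend h a) (extend h b) := by
  apply hom_ext
  intro i
  rw [T'.assoc, extend, tuple_proj, extend.eq_def h b, tuple_proj, T.assoc, ha]

theorem Respects.comp {l m n : ℕ} {a : T.Hom l m} {b : T.Hom m n} (ha : Respects h a)
    (hb : Respects h b) : Respects h (T.comp a b) := by
  intro t
  rw [T.assoc, ha, hb, ha.extend_comp, T'.assoc]

variable
  (h_map : ∀ {m n : ℕ} (f : Fin m → Fin n) (t : T.Hom m 1),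
    h n (T.comp (T.map f) t) = T'.comp (T'.map f) (h m t))
  (h_inst : ∀ {n : ℕ} (t : T.Hom (n + 1) 1) (x : T.Hom n 1),
    h n (T.comp (inst x) t) = T'.comp (inst (h n x)) (h (n + 1) t))
  (h_id : h 1 (T.id 1) = T'.id 1)

include h_map h_id

theorem apply_proj {n : ℕ} (i : Fin n) : h n (T.proj i) = T'.proj i := by
  rw [← T.comp_id (T.proj i), proj, h_map, h_id, T'.comp_id, proj]

theorem extend_map {m n : ℕ} (f : Fin n → Fin m) : extend h (T.map f) = T'.map f := by
  apply hom_ext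
  intro i
  rw [extend, tuple_proj, map_proj, map_proj, apply_proj h_map h_id]

theorem respects_map {m n : ℕ} (f : Fin n → Fin m) : Respects h (T.map f) := by
  intro t
  rw [extend_map h_map h_id, h_map]

include h_inst

theorem respects_inst {n : ℕ} (x : T.Hom n 1) : Respects h (inst x) := by
  have e : extend h (inst x) = inst (h n x) := by
    apply hom_ext
    refine forall_fin_succ ?_ fun i => ?_
    · rw [extend, tuple_proj, inst_proj_zero, inst_proj_zero]
    · rw [extend, tuple_proj, inst_proj_succ, inst_proj_succ, apply_proj h_map h_id]
  intro t
  rw [h_inst, e]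

theorem exists_respects {m n : ℕ} (g : Fin n → T.Hom m 1) :
    ∃ (k : ℕ) (a : T.Hom m k) (r : Fin m → Fin k) (q : Fin n → Fin k), Respects h a ∧
      T.comp a (T.map r) = T.id m ∧ ∀ i, T.comp a (T.proj (q i)) = g i := by
  induction n with
  | zero =>
    refine ⟨m, T.id m, fun i => i, Fin.elim0, ?_, ?_, fun i => i.elim0⟩
    · rw [← T.map_id]
      exact respects_map h_map h_id _
    · rw [T.map_id, T.comp_id]
  | succ n ih =>
    obtain ⟨k, a, r, q, ha, har, haq⟩ := ih fun i => g i.succ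
    refine ⟨k + 1, T.comp a (inst (T.comp (T.map r) (g 0))), fun i => (r i).succ,
      Fin.cases 0 fun i => (q i).succ, ha.comp (respects_inst h_map h_inst h_id _), ?_, ?_⟩
    · rw [T.map_comp Fin.succ r, T.assoc, ← T.assoc (inst _), inst_succ, T.id_comp, har]
    · refine forall_fin_succ ?_ fun i => ?_
      · refine (T.assoc _ _ _).trans ?_
        change T.comp a (T.comp (inst _) (T.proj 0)) = _
        rw [inst_proj_zero, ← T.assoc, har, T.id_comp]
      · refine (T.assoc _ _ _).trans ?_
        change T.comp a (T.comp (inst _) (T.proj (q i).succ)) = _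
        rw [inst_proj_succ, haq]

theorem respects_all {m n : ℕ} (f : T.Hom m n) : Respects h f := by
  obtain ⟨k, a, r, q, ha, -, haq⟩ :=
    exists_respects h_map h_inst h_id fun i => T.comp f (T.proj i)
  have e : f = T.comp a (T.map q) := by
    apply hom_ext
    intro i
    rw [T.assoc, map_proj, haq]
  rw [e]
  exact ha.comp (respects_map h_map h_id q)

theorem exists_mor : ∃ G : Mor T T', ∀ {n : ℕ} (t : T.Hom n 1), G.app t = h n t :=
  ⟨{ app := extend h
     app_comp := fun f g => (respects_all h_map h_inst h_id f).extend_comp g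
     app_map := extend_map h_map h_id }, extend_one h⟩

end

theorem Mor.app_inst {T T' : LawvereTheory.{u}} (G : Mor T T') {n : ℕ} (x : T.Hom n 1) :
    G.app (inst x) = inst (G.app x) := by
  apply hom_ext
  have e : ∀ {k : ℕ} (i : Fin k), T'.proj i = G.app (T.proj i) := fun i => (G.app_map _).symm
  refine forall_fin_succ ?_ fun i => ?_
  · rw [inst_proj_zero, e, ← G.app_comp, inst_proj_zero]
  · rw [inst_proj_succ, e, e, ← G.app_comp, inst_proj_succ]

theorem Mor.app_id {T T' : LawvereTheory.{u}} (G : Mor T T') (n : ℕ) :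
    G.app (T.id n) = T'.id n := by
  rw [← T.map_id, G.app_map, T'.map_id]

end LawvereTheory

/-! ## The equivalence of Lawvere theories and substitution algebras -/

namespace FinCard

open ExpMonad

theorem hom_subst_iff {A A' : FinCard ⥤ Type u} {s : (universalObject.{u} ⟹ A) ⊗ A ⟶ A}
    {s' : (universalObject.{u} ⟹ A') ⊗ A' ⟶ A'}
    {σ : ∀ n : ℕ, A.obj ⟨n + 1⟩ → A.obj ⟨n⟩ → A.obj ⟨n⟩}
    {σ' : ∀ n : ℕ, A'.obj ⟨n + 1⟩ → A'.obj ⟨n⟩ → A'.obj ⟨n⟩}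
    (hs : Represents s σ) (hs' : Represents s' σ') (h : A ⟶ A') :
    s ≫ h = bulletMap universalObject h ≫ s' ↔
      ∀ (n : ℕ) (t : A.obj ⟨n + 1⟩) (x : A.obj ⟨n⟩), ap h (σ n t x) = σ' n (ap h t) (ap h x) := by
  rw [substAt_hom_iff]
  constructor
  · intro e n t x
    have h' := congrArg (ap · (rv fun i => i)) (e (elt₁ t) (elt x))
    simp only [hs _ _ _ _, hs' _ _ _ _, ap_comp, ap_elt_id, ren_rv, ap_elt₁] at h'
    rwa [ren_eq_self (by exact forall_fin_succ rfl fun _ => rfl)] at h'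
  · intro e X f y
    apply ext_ap
    intro n ξ
    rw [ap_comp, hs, hs', e]
    rfl

theorem hom_var_iff {A A' : FinCard ⥤ Type u} {w : universalObject.{u} ⟶ A}
    {w' : universalObject.{u} ⟶ A'} (h : A ⟶ A') :
    w ≫ h = w' ↔ ap h (ap w (vr (0 : Fin 1))) = ap w' (vr (0 : Fin 1)) := by
  constructor
  · rintro rfl
    rfl
  · intro e
    apply ext_ap
    intro n a
    rw [vr_surj a, ap_comp, ap_vr, ap_vr w', ap_ren, e]

/-- The morphism from the universal object given by an element. -/
def ofVar {A : FinCard ⥤ Type u} (x : A.obj ⟨1⟩) : universalObject.{u} ⟶ A :=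
  mkHom (fun _ a => ren A (fun _ => vrInv a) x) fun k a => by
    rw [ren_ren, vrInv_ren]

theorem ap_ofVar {A : FinCard ⥤ Type u} (x : A.obj ⟨1⟩) :
    ap (ofVar x) (vr (0 : Fin 1)) = x :=
  ren_eq_self (fun _ => Subsingleton.elim _ _) x

end FinCard

open FinCard

theorem genVar_curry {C : Type u} [Category.{v} C] [CartesianMonoidalCategory C]
    [MonoidalClosed C] {V A : C} (w : V ⟶ A) : genVar (curry (fst V (𝟙_ C) ≫ w)) = w := by
  rw [genVar, uncurry_curry, ← Category.assoc]
  convert Category.id_comp w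
  simp

/-- A morphism of substitution algebras that is invertible on carriers is an isomorphism. -/
def SubstAlg.isoOfHom {C : Type u} [Category.{v} C] [CartesianMonoidalCategory C]
    [MonoidalClosed C] {V : C} {A B : SubstAlg V} (f : A ⟶ B) (g : B.carrier ⟶ A.carrier)
    (hfg : f.hom ≫ g = 𝟙 _) (hgf : g ≫ f.hom = 𝟙 _) : A ≅ B where
  hom := f
  inv :=
    { hom := g
      v_hom := by
        rw [← f.v_hom, Category.assoc, ← Functor.map_comp, hfg, CategoryTheory.Functor.map_id, Category.comp_id]
      s_hom := by
        have e : ExpMonad.bulletMap V g ≫ ExpMonad.bulletMap V f.hom = 𝟙 _ := by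
          rw [ExpMonad.bulletMap, ExpMonad.bulletMap, MonoidalCategory.tensorHom_comp_tensorHom,
            ← Functor.map_comp, hgf, CategoryTheory.Functor.map_id, MonoidalCategory.id_tensorHom_id]
        rw [← Category.id_comp (B.s ≫ g), ← e, Category.assoc, ← Category.assoc _ B.s, ← f.s_hom,
          Category.assoc, hfg, Category.comp_id] }
  hom_inv_id := SubstAlg.Hom.ext hfg
  inv_hom_id := SubstAlg.Hom.ext hgf

namespace LawvereTheory

theorem subAx (T : LawvereTheory.{u}) :
    SubAx (operations.obj T) (fun _ t x => T.comp (inst x) t) (T.id 1) where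
  ren_sub := T.substSet.map_sub
  left_var := T.substSet.left_var
  contract := T.substSet.contract
  weaken := T.substSet.weaken
  assoc := T.substSet.assoc

/-- The substitution morphism of the operations of a Lawvere theory. -/
def substHom (T : LawvereTheory.{u}) :
    (universalObject.{u} ⟹ operations.obj T) ⊗ operations.obj T ⟶ operations.obj T :=
  ofSub _ T.subAx.ren_sub

theorem represents_substHom (T : LawvereTheory.{u}) :
    Represents T.substHom (fun _ t x => T.comp (inst x) t) :=
  represents_ofSub _ T.subAx.ren_sub

/-- The generic variable of the operations of a Lawvere theory. -/
def varHom (T : LawvereTheory.{u}) :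
    𝟙_ (FinCard ⥤ Type u) ⟶ (universalObject.{u} ⟹ operations.obj T) :=
  curry (fst _ _ ≫ ofVar (A := operations.obj T) (T.id 1))

theorem ap_genVar_varHom (T : LawvereTheory.{u}) :
    ap (genVar T.varHom) (vr (0 : Fin 1)) = T.id 1 := by
  rw [varHom, genVar_curry]
  exact ap_ofVar _

/-- The substitution algebra of a Lawvere theory. -/
def substAlg (T : LawvereTheory.{u}) : SubstAlg universalObject.{u} :=
  SubstAlg.ofIsSubst T.substHom T.varHom
    (SubAx.isSubst T.represents_substHom (by
      rw [ap_genVar_varHom]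
      exact T.subAx))

/-- The functor from Lawvere theories to substitution algebras. -/
def toSubstAlg : LawvereTheory.{u} ⥤ SubstAlg universalObject.{u} where
  obj T := T.substAlg
  map {T T'} G :=
    { hom := operations.map G
      v_hom := by
        refine (genVar_hom_iff _ _ _).2 ((hom_var_iff _).2 ?_)
        refine (congrArg (ap _) T.ap_genVar_varHom).trans (Eq.trans ?_ T'.ap_genVar_varHom.symm)
        exact Mor.app_id G 1
      s_hom := by
        refine (hom_subst_iff T.represents_substHom
          T'.represents_substHom _).2 ?_
        intro n t x
        exact (Mor.app_comp G _ _).trans (congrArg (T'.comp · _) (Mor.app_inst G x)) }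
  map_id T := SubstAlg.Hom.ext (operations.map_id T)
  map_comp G G' := SubstAlg.Hom.ext (operations.map_comp G G')

instance : toSubstAlg.{u}.Faithful where
  map_injective {T T'} G G' e := by
    have e' : ∀ {n : ℕ} (t : T.Hom n 1), Mor.app G t = Mor.app G' t := fun {n} t =>
      congrArg (fun f : operations.obj T ⟶ operations.obj T' => ap (n := n) f t)
        (congrArg SubstAlg.Hom.hom e)
    refine Mor.ext (funext fun m => funext fun n => funext fun f => hom_ext fun i => ?_)
    have hp : ∀ G : Mor T T', T'.comp (G.app f) (T'.proj i) = G.app (T.comp f (T.proj i)) :=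
      fun G => by rw [G.app_comp, proj, proj, G.app_map]
    exact (hp G).trans ((e' _).trans (hp G').symm)

instance : toSubstAlg.{u}.Full where
  map_surjective {T T'} F := by
    let f : operations.obj T ⟶ operations.obj T' := F.hom
    have h_inst := (hom_subst_iff T.represents_substHom
          T'.represents_substHom f).1 F.s_hom
    have h_id := (hom_var_iff f).1 ((genVar_hom_iff _ _ _).1 F.v_hom)
    replace h_id : ap f (T.id 1 : (operations.obj T).obj ⟨1⟩) = T'.id 1 :=
      (congrArg (ap f) T.ap_genVar_varHom).symm.trans (h_id.trans T'.ap_genVar_varHom)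
    obtain ⟨G, hG⟩ := exists_mor (T := T) (T' := T') (h := fun n t => ap (n := n) f t)
      (fun k t => ap_ren f k t) (fun t x => h_inst _ t x) h_id
    exact ⟨G, SubstAlg.Hom.ext (ext_ap (f := operations.map G) (g := f) fun n t => hG t)⟩

end LawvereTheory

namespace SubstSet

variable (S : SubstSet.{u})

theorem lawvere_tuple {m n : ℕ} (g : Fin n → S.lawvere.Hom m 1) (i : Fin n) :
    (S.lawvere.tuple g : Fin n → S.obj m) i = (g i : Fin 1 → S.obj m) 0 := by
  have h := congrFun (S.lawvere.tuple_proj g i) (0 : Fin 1)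
  exact (Mod.self_subst_vari i _).symm.trans h

theorem lawvere_inst {n : ℕ} (t : S.lawvere.Hom (n + 1) 1) (x : S.lawvere.Hom n 1) :
    (S.lawvere.comp (LawvereTheory.inst x) t : Fin 1 → S.obj n) 0 =
      S.sub ((t : Fin 1 → S.obj (n + 1)) 0) ((x : Fin 1 → S.obj n) 0) := by
  have h0 : (LawvereTheory.inst x : Fin (n + 1) → S.obj n) 0 = (x : Fin 1 → S.obj n) 0 :=
    S.lawvere_tuple _ 0
  have hs : (fun i : Fin n => (LawvereTheory.inst x : Fin (n + 1) → S.obj n) i.succ) =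
      fun i => S.vari i := funext fun i => S.lawvere_tuple _ i.succ
  change S.sub (S.self.shift.subst (n := n) ((t : Fin 1 → S.obj (n + 1)) 0)
    fun i : Fin n => (LawvereTheory.inst x : Fin (n + 1) → S.obj n) i.succ) _ = _
  rw [h0, hs]
  refine congrArg (S.sub · _) ((S.self.shift.subst_vari _ fun i => i).trans ?_)
  exact S.self.shift.map_id _

end SubstSet

namespace SubstAlg

variable (B : SubstAlg universalObject.{u})

/-- The elementary substitution algebra of a substitution algebra. -/
def substSet : SubstSet.{u} := B.isSubst.subAx.substSet

/-- The comparison of a substitution algebra with that of its Lawvere theory. -/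
def counitHom : LawvereTheory.operations.obj B.substSet.lawvere ⟶ B.carrier :=
  mkHom (fun _ t => (t : Fin 1 → B.carrier.obj _) 0) fun k t =>
    B.substSet.self.subst_vari ((t : Fin 1 → B.carrier.obj _) 0) k

/-- The inverse of the comparison. -/
def counitInv : B.carrier ⟶ LawvereTheory.operations.obj B.substSet.lawvere :=
  mkHom (fun n x => (fun _ => x : Fin 1 → B.carrier.obj ⟨n⟩)) fun k x =>
    funext fun _ => (B.substSet.self.subst_vari x k).symm

/-- Every substitution algebra is that of a Lawvere theory. -/
def counitIso : B.substSet.lawvere.substAlg ≅ B :=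
  isoOfHom
    { hom := B.counitHom
      v_hom := by
        refine (genVar_hom_iff _ _ _).2 ((hom_var_iff _).2 ?_)
        refine (congrArg (ap B.counitHom) B.substSet.lawvere.ap_genVar_varHom).trans ?_
        exact ren_eq_self (fun _ => Subsingleton.elim _ _) _
      s_hom := by
        refine (hom_subst_iff B.substSet.lawvere.represents_substHom (represents_subOf B.s) B.counitHom).2 ?_
        intro n t x
        exact B.substSet.lawvere_inst t x }
    B.counitInv
    (ext_ap (f := B.counitHom ≫ B.counitInv) (g := 𝟙 _) fun n t => funext fun i =>
      congrArg (t : Fin 1 → B.carrier.obj ⟨n⟩) (Subsingleton.elim 0 i))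
    (ext_ap (f := B.counitInv ≫ B.counitHom) (g := 𝟙 _) fun _ _ => rfl)

end SubstAlg

instance : LawvereTheory.toSubstAlg.{u}.EssSurj where
  mem_essImage B := ⟨B.substSet.lawvere, ⟨B.counitIso⟩⟩

instance : LawvereTheory.toSubstAlg.{u}.IsEquivalence where

theorem SubstOp.natCard : Nat.card SubstOp = 2 := by
  have e : SubstOp ≃ Bool :=
    { toFun := fun | .subst => true | .var => false
      invFun := fun b => if b then .subst else .var
      left_inv := by rintro (_ | _) <;> rfl
      right_inv := by rintro (_ | _) <;> rfl }
  rw [Nat.card_congr e, Nat.card_eq_fintype_card, Fintype.card_bool]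

theorem SubstEqn.natCard : Nat.card SubstEqn = 4 := by
  have e : SubstEqn ≃ Bool × Bool :=
    { toFun := fun
        | .leftVar => (true, true)
        | .contract => (true, false)
        | .weaken => (false, true)
        | .assoc => (false, false)
      invFun := fun
        | (true, true) => .leftVar
        | (true, false) => .contract
        | (false, true) => .weaken
        | (false, false) => .assoc
      left_inv := by rintro (_ | _ | _ | _) <;> rfl
      right_inv := by rintro ⟨_ | _, _ | _⟩ <;> rfl }
  rw [Nat.card_congr e, Nat.card_eq_fintype_card, Fintype.card_prod, Fintype.card_bool]

end

theorem mainTheorem2 :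
    (∃ E : LawvereTheory.{u} ≌ SubstAlg universalObject.{u},
      Nonempty (E.functor ⋙ SubstAlg.forget universalObject.{u} ≅ LawvereTheory.operations.{u})) ∧
    (∃ M : (substTheory universalObject.{u}).Alg ≌ SubstAlg universalObject.{u},
      Nonempty (M.functor ⋙ SubstAlg.forget universalObject.{u} ≅
        CatPres.Alg.forget (substTheory universalObject.{u}))) ∧
    Nat.card (substTheory universalObject.{u}).sig.Op = 2 ∧
    Nat.card (substTheory universalObject.{u}).Eqn = 4 :=
  ⟨⟨LawvereTheory.toSubstAlg.asEquivalence, ⟨Iso.refl _⟩⟩,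
    substTheory_alg_equivalence universalObject.{u}, SubstOp.natCard, SubstEqn.natCard⟩
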